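/- **Conventions.** Here a metric measure space $(X,\mathsf d,\mathfrak m)$ is a complete metric space $(X,\mathsf d)$ with a finite Borel measure $\mathfrak m$ of full support (in particular, $\mathfrak m$ may be a probability measure). Let $\mathcal P(X)$ be the set of Borel probability measures on $X$. For $\mu,\nu\in\mathcal P(X)$ put $$W_2^2(\mu,\nu)=\inf_{\pi}\int_{X\times X}\mathsf d^2(x,y)\,d\pi(x,y)\in[0,\infty],$$ the infimum being over all couplings $\pi$ of $\mu$ and $\nu$. The relative entropy is $\mathrm{Ent}_{\mathfrak m}(\mu)=\int\rho\ln\rho\,d\mathfrak m\in(-\infty,+\infty]$ if $\mu=\rho\,\mathfrak m$, and $\mathrm{Ent}_{\mathfrak m}(\mu)=+\infty$ if $\mu$ is not absolutely continuous with respect to $\mathfrak m$. For a probability measure $\Omega$ on $\mathcal P(X)$ let $$\mathrm{Var}(\Omega)=\inf_{\nu\in\mathcal P(X)}\int_{\mathcal P(X)}W_2^2(\mu,\nu)\,d\Omega(\mu);$$ a (Wasserstein) barycenter of $\Omega$ is a $\bar\mu\in\mathcal P(X)$ at which $\nu\mapsto\int_{\mathcal P(X)} W_2^2(\mu,\nu)\,d\Omega(\mu)$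 attains its minimum. **Definition ($\mathrm{BCD}(K,\infty)$).** Let $K\in\mathbb R$. The space $(X,\mathsf d,\mathfrak m)$ is a $\mathrm{BCD}(K,\infty)$ space if every probability measure $\Omega$ on $\mathcal P(X)$ that is concentrated on finitely many measures and satisfies $\mathrm{Var}(\Omega)<\infty$ has a barycenter $\bar\mu$ with $$\mathrm{Ent}_{\mathfrak m}(\bar\mu)\le\int_{\mathcal P(X)}\mathrm{Ent}_{\mathfrak m}(\mu)\,d\Omega(\mu)-\frac K2\,\mathrm{Var}(\Omega).$$ **Definition (measured Gromov–Hausdorff convergence).** A map $\varphi:(X_1,\mathsf d_1)\to(X_2,\mathsf d_2)$ is an $\varepsilon$-approximation if $|\mathsf d_2(\varphi(x),\varphi(y))-\mathsf d_1(x,y)|\le\varepsilon$ for all $x,y\in X_1$ and every $x_2\in X_2$ satisfies $\mathsf d_2(\varphi(x_1),x_2)\le\varepsilon$ for some $x_1\in X_1$. The sequence $(X_i,\mathsf d_i,\mathfrak m_i)_{i\in\mathbb N}$ converges to $(X,\mathsf d,\mathfrak m)$ in the measured Gromov–Hausdorff sense if there are Borel measurable $\varepsilon_i$-approximations $\varphi_i:X_i\to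 X$ with $\varepsilon_i\to0$ such that $\int_X g\,d(\varphi_i)_\sharp\mathfrak m_i\to\int_X g\,d\mathfrak m$ for every bounded continuous $g:X\to\mathbb R$. **Theorem (Stability of $\mathrm{BCD}(K,\infty)$).** Let $K\in\mathbb R$ and let $(X_i,\mathsf d_i,\mathfrak m_i)_{i\in\mathbb N}$ be a sequence of compact $\mathrm{BCD}(K,\infty)$ metric measure spaces converging to a metric measure space $(X,\mathsf d,\mathfrak m)$ in the measured Gromov–Hausdorff sense. Then $(X,\mathsf d,\mathfrak m)$ is also a $\mathrm{BCD}(K,\infty)$ space. -/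

import Mathlib

open MeasureTheory Filter Topology
open scoped ENNReal BoundedContinuousFunction

noncomputable section

namespace BCD

/-- The squared Wasserstein distance `W₂²(μ, ν)`: the infimum of `∫ d(x, y)² dπ(x, y)` over all
couplings `π` of `μ` and `ν`, as an extended nonnegative real. -/
def wassersteinSq {X : Type*} [MetricSpace X] [MeasurableSpace X]
    (μ ν : ProbabilityMeasure X) : ℝ≥0∞ :=
  ⨅ (π : Measure (X × X)) (_ : π.fst = (μ : Measure X) ∧ π.snd = (ν : Measure X)),
    ∫⁻ p, edist p.1 p.2 ^ 2 ∂π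

/-- The mean squared Wasserstein distance `∫ W₂²(μ, ν) dΩ(μ)` from `ν` to a measure `Ω` on the
space of probability measures. -/
def meanWassersteinSq {X : Type*} [MetricSpace X] [MeasurableSpace X]
    (Ω : Measure (ProbabilityMeasure X)) (ν : ProbabilityMeasure X) : ℝ≥0∞ :=
  ∫⁻ μ, wassersteinSq μ ν ∂Ω

/-- The variance `Var(Ω) = inf_ν ∫ W₂²(μ, ν) dΩ(μ)`. -/
def wassersteinVar {X : Type*} [MetricSpace X] [MeasurableSpace X]
    (Ω : Measure (ProbabilityMeasure X)) : ℝ≥0∞ :=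
  ⨅ ν : ProbabilityMeasure X, meanWassersteinSq Ω ν

/-- `ν` is a Wasserstein barycenter of `Ω`: it minimizes `∫ W₂²(μ, ·) dΩ(μ)`. -/
def IsWassersteinBarycenter {X : Type*} [MetricSpace X] [MeasurableSpace X]
    (Ω : Measure (ProbabilityMeasure X)) (ν : ProbabilityMeasure X) : Prop :=
  ∀ ν' : ProbabilityMeasure X, meanWassersteinSq Ω ν ≤ meanWassersteinSq Ω ν'

open scoped Classical in
/-- The relative entropy `Ent_m(μ) = ∫ ρ ln ρ dm` if `μ = ρ m`, and `+∞` if `μ` is not absolutely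
continuous. For a finite measure `m` the negative part of `ρ ln ρ` is always integrable, so the
integral is `+∞` when `ρ ln ρ` is not integrable. -/
def relEntropy {X : Type*} [MeasurableSpace X] (m : Measure X) (μ : ProbabilityMeasure X) :
    EReal :=
  if (μ : Measure X) ≪ m ∧
      Integrable (fun x => ((μ : Measure X).rnDeriv m x).toReal *
        Real.log ((μ : Measure X).rnDeriv m x).toReal) m then
    ((∫ x, ((μ : Measure X).rnDeriv m x).toReal *
        Real.log ((μ : Measure X).rnDeriv m x).toReal ∂m : ℝ) : EReal)
  else ⊤

/-- The integral of an extended-real-valued function, as the integral of the positive part minus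
the integral of the negative part. -/
def erealIntegral {α : Type*} [MeasurableSpace α] (Ω : Measure α) (F : α → EReal) : EReal :=
  ((∫⁻ a, (F a).toENNReal ∂Ω : ℝ≥0∞) : EReal) - ((∫⁻ a, (-F a).toENNReal ∂Ω : ℝ≥0∞) : EReal)

/-- The `BCD(K, ∞)` condition for a metric space with a finite Borel measure `m`: every probability
measure `Ω` on the space of probability measures that is concentrated on finitely many measures
and has finite variance has a Wasserstein barycenter satisfying Jensen's inequality. -/
def IsBCD {X : Type*} [MetricSpace X] [MeasurableSpace X] (K : ℝ) (m : Measure X) : Prop :=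
  ∀ Ω : Measure (ProbabilityMeasure X), IsProbabilityMeasure Ω →
    (∃ S : Set (ProbabilityMeasure X), S.Finite ∧ ∀ᵐ μ ∂Ω, μ ∈ S) →
    wassersteinVar Ω < ∞ →
    ∃ ν : ProbabilityMeasure X, IsWassersteinBarycenter Ω ν ∧
      relEntropy m ν ≤
        erealIntegral Ω (relEntropy m) - ((K / 2 * (wassersteinVar Ω).toReal : ℝ) : EReal)

/-- `φ` is an `ε`-approximation between metric spaces. -/
def IsApproximation {X Y : Type*} [MetricSpace X] [MetricSpace Y] (ε : ℝ) (φ : X → Y) : Prop :=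
  (∀ x x' : X, |dist (φ x) (φ x') - dist x x'| ≤ ε) ∧ ∀ y : Y, ∃ x : X, dist (φ x) y ≤ ε

/-- Measured Gromov--Hausdorff convergence of `(X i, m i)` to `(Y, mY)`: there are Borel
`ε i`-approximations `φ i : X i → Y` with `ε i → 0` such that the push-forwards of `m i` under `φ i`
converge weakly to `mY`. -/
def MeasuredGHConverges {X : ℕ → Type*} [∀ i, MetricSpace (X i)] [∀ i, MeasurableSpace (X i)]
    {Y : Type*} [MetricSpace Y] [MeasurableSpace Y]
    (m : ∀ i, Measure (X i)) (mY : Measure Y) : Prop :=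
  ∃ (ε : ℕ → ℝ) (φ : ∀ i, X i → Y),
    Tendsto ε atTop (𝓝 0) ∧
    (∀ i, IsApproximation (ε i) (φ i)) ∧
    (∀ i, Measurable (φ i)) ∧
    ∀ g : Y →ᵇ ℝ, Tendsto (fun i => ∫ y, g y ∂((m i).map (φ i))) atTop (𝓝 (∫ y, g y ∂mY))

end BCD

end

/-! The space $Y$ is compact, being complete and approximated by compact spaces. If some atom of
$\Omega$ has infinite entropy, any barycenter works. Otherwise the finitely many atoms are moved to
$X_i$, the `IsBCD` hypothesis there yields a barycenter, and its image in $Y$ is followed to a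
limit.

The transfer uses a partition of $Y$ into small cells with `mY`-null frontiers. `T` spreads the mass
of a cell over the corresponding cell of $X_i$ proportionally to `m i`. Coarse-graining does not
increase entropy (`cellEntropy_le`), and cell masses converge
(`tendsto_measureReal_of_null_frontier`), so the entropy of `T μ` is at most that of `μ` up to a
small error. Every point moves by little, and `μ` is recovered by redistributing `T μ` cellwise;
hence squared Wasserstein distances, and with them variances, change little in both directions
(`IsApproximation.exists_transfer`).

The images in $Y$ of the barycenters are then almost minimizers. A weak limit exists by compactness
of the space of probability measures; it is a barycenter because $W_2^2$ is lower semicontinuous,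
and it inherits Jensen's inequality because entropy is a supremum of expressions in bounded
continuous test functions, stable under joint convergence of both measures
(`relEntropy_le_of_tendsto`). -/

namespace BCD

open ProbabilityTheory

/-! ### Variational (Donsker--Varadhan) description of the entropy. -/

/-- Young's inequality: $g\mapsto e^{g-1}$ is the convex conjugate of $r\mapsto r\ln r$, with
equality at $g=1+\ln r$. -/
theorem mul_sub_exp_sub_one_le {r : ℝ} (hr : 0 ≤ r) (g : ℝ) :
    r * g - Real.exp (g - 1) ≤ r * Real.log r := by
  rcases hr.eq_or_lt with rfl | hr
  · simp [Real.exp_nonneg]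
  · have h := Real.add_one_le_exp (g - 1 - Real.log r)
    rw [Real.exp_sub, Real.exp_log hr, le_div_iff₀ hr] at h
    nlinarith

section Measurable

variable {X : Type*} [MeasurableSpace X] {m : Measure X} {μ : ProbabilityMeasure X}

theorem integrable_of_abs_le {m : Measure X} [IsFiniteMeasure m] {g : X → ℝ} (hg : Measurable g)
    {C : ℝ} (hC : ∀ x, |g x| ≤ C) : Integrable g m :=
  Integrable.of_bound hg.aestronglyMeasurable C (ae_of_all _ hC)

theorem integrable_exp_of_abs_le {m : Measure X} [IsFiniteMeasure m] {g : X → ℝ}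
    (hg : Measurable g) {C : ℝ} (hC : ∀ x, |g x| ≤ C) :
    Integrable (fun x => Real.exp (g x - 1)) m :=
  Integrable.of_bound (by fun_prop) (Real.exp (C - 1)) (ae_of_all _ fun x => by
    rw [Real.norm_eq_abs, Real.abs_exp, Real.exp_le_exp]
    linarith [(abs_le.1 (hC x)).2])

/-- The easy half of the Donsker--Varadhan formula. -/
theorem integral_sub_integral_exp_le_of_relEntropy_eq [IsFiniteMeasure m] {e : ℝ}
    (he : relEntropy m μ = e)
    {g : X → ℝ} (hg : Measurable g) {C : ℝ} (hC : ∀ x, |g x| ≤ C) :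
    ∫ x, g x ∂(μ : Measure X) - ∫ x, Real.exp (g x - 1) ∂m ≤ e := by
  unfold relEntropy at he
  split_ifs at he with h
  · have he' := EReal.coe_injective he
    have hi : Integrable (fun x => ((μ : Measure X).rnDeriv m x).toReal * g x) m := by
      have := (integrable_rnDeriv_smul_iff h.1 (f := g)).2
        (integrable_of_abs_le (m := (μ : Measure X)) hg hC)
      simpa [smul_eq_mul] using this
    have h1 : ∫ x, g x ∂(μ : Measure X) = ∫ x, ((μ : Measure X).rnDeriv m x).toReal * g x ∂m := by
      rw [← integral_rnDeriv_smul h.1]; simp [smul_eq_mul]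
    rw [h1, ← he', ← integral_sub hi (integrable_exp_of_abs_le hg hC)]
    exact integral_mono (hi.sub (integrable_exp_of_abs_le hg hC)) h.2
      fun x => mul_sub_exp_sub_one_le ENNReal.toReal_nonneg _
  · exact absurd he (by simp)

/-- Test with $t\,1_A$ for an $\mathfrak m$-null set $A$: the exponential term does not depend on
$t$, while $t\mu(A)$ is unbounded unless $\mu(A)=0$. -/
theorem absolutelyContinuous_of_forall_integral_sub_le {r : ℝ}
    (H : ∀ g : X → ℝ, Measurable g → (∃ C, ∀ x, |g x| ≤ C) →
      ∫ x, g x ∂(μ : Measure X) - ∫ x, Real.exp (g x - 1) ∂m ≤ r) :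
    (μ : Measure X) ≪ m := by
  refine Measure.AbsolutelyContinuous.mk fun A hA hmA => ?_
  by_contra hne
  have hpos : 0 < (μ : Measure X).real A :=
    ENNReal.toReal_pos hne (measure_ne_top _ _)
  have key : ∀ t : ℝ, t * (μ : Measure X).real A ≤ r + Real.exp (-1) * m.real Set.univ := by
    intro t
    have h := H (A.indicator fun _ => t) (measurable_const.indicator hA)
      ⟨|t|, fun x => by by_cases hx : x ∈ A <;> simp [hx]⟩
    have h1 : ∫ x, Real.exp (A.indicator (fun _ => t) x - 1) ∂m = ∫ _, Real.exp (-1) ∂m := by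
      refine integral_congr_ae ?_
      filter_upwards [measure_eq_zero_iff_ae_notMem.1 hmA] with x hx
      simp [hx]
    rw [h1, integral_indicator_const _ hA, integral_const, smul_eq_mul, smul_eq_mul] at h
    linarith
  obtain ⟨n, hn⟩ := exists_nat_gt ((r + Real.exp (-1) * m.real Set.univ) / (μ : Measure X).real A)
  rw [div_lt_iff₀ hpos] at hn
  linarith [key n]

/-- The truncation of a real number to `[1 / (n + 1), n + 1]`. -/
noncomputable def trunc (n : ℕ) (r : ℝ) : ℝ := max (1 / (n + 1 : ℝ)) (min r (n + 1))

theorem trunc_pos (n : ℕ) (r : ℝ) : 0 < trunc n r :=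
  lt_max_of_lt_left (by positivity)

theorem trunc_le (n : ℕ) (r : ℝ) : trunc n r ≤ n + 1 := by
  refine max_le ?_ (min_le_right _ _)
  rw [div_le_iff₀ (by positivity)]
  nlinarith [n.cast_nonneg (α := ℝ)]

theorem measurable_trunc (n : ℕ) : Measurable (trunc n) := by
  unfold trunc; fun_prop

theorem abs_one_add_log_trunc_le (n : ℕ) (r : ℝ) :
    |1 + Real.log (trunc n r)| ≤ 1 + Real.log (n + 1) := by
  have h1 : Real.log (trunc n r) ≤ Real.log (n + 1) :=
    Real.log_le_log (trunc_pos n r) (trunc_le n r)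
  have h2 : -Real.log (n + 1) ≤ Real.log (trunc n r) := by
    rw [← Real.log_inv, ← one_div]
    exact Real.log_le_log (by positivity) (le_max_left _ _)
  have h3 : 0 ≤ Real.log (n + 1 : ℝ) := Real.log_nonneg (by linarith [n.cast_nonneg (α := ℝ)])
  rw [abs_le]; constructor <;> linarith

/-- Adding 1 to the truncated integrand makes it nonnegative uniformly in `n`, which is what Fatou's
lemma needs. -/
theorem trunc_integrand_nonneg (n : ℕ) {r : ℝ} (hr : 0 ≤ r) :
    0 ≤ r * (1 + Real.log (trunc n r)) - trunc n r + 1 := by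
  have hn : (0 : ℝ) ≤ n := n.cast_nonneg
  have hn1 : 1 / (n + 1 : ℝ) ≤ 1 := by rw [div_le_one (by positivity)]; linarith
  rcases le_or_gt r (trunc n r) with h | h
  · have h1 : r - 1 ≤ r * Real.log r := by
      have := InformationTheory.klFun_nonneg hr
      rw [InformationTheory.klFun_apply] at this; linarith
    have h2 : r * Real.log r ≤ r * Real.log (trunc n r) := by
      rcases hr.eq_or_lt with rfl | hr
      · simp
      · exact mul_le_mul_of_nonneg_left (Real.log_le_log hr h) hr.le
    rcases le_or_gt (min r (n + 1)) (1 / (n + 1 : ℝ)) with h3 | h3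
    · have h5 : trunc n r ≤ 1 := by rw [trunc, max_eq_left h3]; exact hn1
      have h6 : 1 - (trunc n r)⁻¹ ≤ 0 := by
        have := (one_le_inv₀ (trunc_pos n r)).2 h5; linarith
      have h7 : r * (1 - (trunc n r)⁻¹) ≤ r * Real.log (trunc n r) :=
        mul_le_mul_of_nonneg_left (Real.one_sub_inv_le_log_of_pos (trunc_pos n r)) hr
      have h8 : trunc n r * (1 - (trunc n r)⁻¹) ≤ r * (1 - (trunc n r)⁻¹) :=
        mul_le_mul_of_nonpos_right h h6
      have h9 : trunc n r * (1 - (trunc n r)⁻¹) = trunc n r - 1 := by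
        have := (trunc_pos n r).ne'
        field_simp
      linarith
    · have h5 : trunc n r ≤ r := by rw [trunc, max_eq_right h3.le]; exact min_le_left _ _
      linarith
  · have h3 : 1 ≤ trunc n r := by
      rw [trunc] at h ⊢
      rcases le_total r (n + 1 : ℝ) with h4 | h4
      · rw [min_eq_left h4] at h
        exact absurd (le_max_right _ _) h.not_ge
      · rw [min_eq_right h4]
        exact le_max_of_le_right (by linarith)
    have := mul_nonneg hr (Real.log_nonneg h3)
    linarith

theorem tendsto_trunc {r : ℝ} (hr : 0 ≤ r) : Tendsto (fun n => trunc n r) atTop (𝓝 r) := by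
  have h1 : Tendsto (fun n : ℕ => max (1 / (n + 1 : ℝ)) r) atTop (𝓝 (max 0 r)) :=
    tendsto_one_div_add_atTop_nhds_zero_nat.max tendsto_const_nhds
  rw [max_eq_right hr] at h1
  refine h1.congr' ?_
  obtain ⟨N, hN⟩ := exists_nat_gt r
  filter_upwards [eventually_ge_atTop N] with n hn
  have : (N : ℝ) ≤ n := by exact_mod_cast hn
  rw [trunc, min_eq_left (by linarith)]

theorem tendsto_trunc_integrand {r : ℝ} (hr : 0 ≤ r) :
    Tendsto (fun n => r * (1 + Real.log (trunc n r)) - trunc n r + 1) atTop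
      (𝓝 (r * Real.log r + 1)) := by
  have h := tendsto_trunc hr
  rcases hr.eq_or_lt with rfl | hr
  · simpa using (h.neg.add_const 1)
  · have := (((h.log hr.ne').const_add 1).const_mul r).sub h |>.add_const 1
    convert this using 2
    ring

/-- The optimal test function $1+\ln\rho$ may be unbounded, so $\rho$ is truncated inside the
logarithm. Fatou's lemma removes the truncation, giving integrability of $\rho\ln\rho$ and the bound
at once. -/
theorem relEntropy_le_of_forall_integral_sub_le [IsFiniteMeasure m] {r : ℝ}
    (H : ∀ g : X → ℝ, Measurable g → (∃ C, ∀ x, |g x| ≤ C) →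
      ∫ x, g x ∂(μ : Measure X) - ∫ x, Real.exp (g x - 1) ∂m ≤ r) :
    relEntropy m μ ≤ r := by
  have hac := absolutelyContinuous_of_forall_integral_sub_le H
  set ρ : X → ℝ := fun x => ((μ : Measure X).rnDeriv m x).toReal with hρ
  have hρm : Measurable ρ := (Measure.measurable_rnDeriv _ _).ennreal_toReal
  have hρ0 : ∀ x, 0 ≤ ρ x := fun x => ENNReal.toReal_nonneg
  set q : ℕ → X → ℝ := fun n x => ρ x * (1 + Real.log (trunc n (ρ x))) - trunc n (ρ x) + 1 with hq
  have hfm : ∀ n, Measurable fun x => trunc n (ρ x) := fun n => (measurable_trunc n).comp hρm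
  have hqm : ∀ n, Measurable (q n) := fun n => by
    have := hfm n
    simp only [hq]; fun_prop
  have hqi : ∀ n, ∫⁻ x, ENNReal.ofReal (q n x) ∂m ≤ ENNReal.ofReal (r + m.real Set.univ) := by
    intro n
    set g : X → ℝ := fun x => 1 + Real.log (trunc n (ρ x)) with hg
    have hgm : Measurable g := by have := hfm n; simp only [hg]; fun_prop
    have hgC : ∀ x, |g x| ≤ 1 + Real.log (n + 1) := fun x => abs_one_add_log_trunc_le n _
    have hexp : ∀ x, Real.exp (g x - 1) = trunc n (ρ x) := fun x => by
      simp only [hg, add_sub_cancel_left]; exact Real.exp_log (trunc_pos _ _)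
    have hi : Integrable (fun x => ρ x * g x) m := by
      have := (integrable_rnDeriv_smul_iff hac (f := g)).2
        (integrable_of_abs_le (m := (μ : Measure X)) hgm hgC)
      simpa [smul_eq_mul] using this
    have h1 : ∫ x, g x ∂(μ : Measure X) = ∫ x, ρ x * g x ∂m := by
      rw [← integral_rnDeriv_smul hac]; simp [smul_eq_mul, hρ]
    have hti : Integrable (fun x => trunc n (ρ x)) m := by
      have := integrable_exp_of_abs_le (m := m) hgm hgC
      simpa only [hexp] using this
    have h2 := H g hgm ⟨_, hgC⟩
    simp only [hexp] at h2
    have hqint : Integrable (q n) m := (hi.sub hti).add (integrable_const 1)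
    rw [← ofReal_integral_eq_lintegral_ofReal hqint
      (ae_of_all _ fun x => trunc_integrand_nonneg n (hρ0 x))]
    refine ENNReal.ofReal_le_ofReal ?_
    have h3 : ∫ x, q n x ∂m = ∫ x, ρ x * g x ∂m - ∫ x, trunc n (ρ x) ∂m + m.real Set.univ := by
      have := integral_add (hi.sub hti) (integrable_const (1 : ℝ))
      simp only [Pi.sub_apply] at this
      rw [integral_sub hi hti, integral_const, smul_eq_mul, mul_one] at this
      exact this
    rw [h3]; linarith
  have hlim : ∫⁻ x, ENNReal.ofReal (ρ x * Real.log (ρ x) + 1) ∂m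
      ≤ ENNReal.ofReal (r + m.real Set.univ) := by
    calc ∫⁻ x, ENNReal.ofReal (ρ x * Real.log (ρ x) + 1) ∂m
        = ∫⁻ x, liminf (fun n => ENNReal.ofReal (q n x)) atTop ∂m := by
          refine lintegral_congr fun x => ?_
          exact ((ENNReal.continuous_ofReal.tendsto _).comp
            (tendsto_trunc_integrand (hρ0 x))).liminf_eq.symm
      _ ≤ liminf (fun n => ∫⁻ x, ENNReal.ofReal (q n x) ∂m) atTop :=
          lintegral_liminf_le fun n => (hqm n).ennreal_ofReal
      _ ≤ ENNReal.ofReal (r + m.real Set.univ) := by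
          refine (liminf_le_liminf (Eventually.of_forall hqi)).trans ?_
          simp
  have hnn : ∀ x, 0 ≤ ρ x * Real.log (ρ x) + 1 := fun x => by
    have := InformationTheory.klFun_nonneg (hρ0 x)
    rw [InformationTheory.klFun_apply] at this; linarith [hρ0 x]
  have hmeas : Measurable fun x => ρ x * Real.log (ρ x) + 1 := by fun_prop
  have hint1 : Integrable (fun x => ρ x * Real.log (ρ x) + 1) m :=
    lintegral_ofReal_ne_top_iff_integrable hmeas.aestronglyMeasurable (ae_of_all _ hnn) |>.1
      (ne_top_of_le_ne_top ENNReal.ofReal_ne_top hlim)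
  have hint : Integrable (fun x => ρ x * Real.log (ρ x)) m := by
    refine (hint1.sub (integrable_const (1 : ℝ))).congr (ae_of_all _ fun x => ?_)
    simp
  have hr0 : 0 ≤ r + m.real Set.univ := by
    have h := H (fun _ => 0) measurable_const ⟨0, by simp⟩
    simp only [integral_zero, zero_sub, integral_const, smul_eq_mul] at h
    have h1 : Real.exp (-1) ≤ 1 := by rw [Real.exp_le_one_iff]; norm_num
    nlinarith [measureReal_nonneg (μ := m) (s := Set.univ)]
  rw [← ofReal_integral_eq_lintegral_ofReal hint1 (ae_of_all _ hnn),
    ENNReal.ofReal_le_ofReal_iff hr0, integral_add hint (integrable_const 1), integral_const,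
    smul_eq_mul, mul_one, add_le_add_iff_right] at hlim
  rw [relEntropy, if_pos ⟨hac, hint⟩]
  exact_mod_cast hlim

/-- The entropy of a measure with a given density. -/
theorem relEntropy_eq_of_withDensity [SigmaFinite m] {f : X → ℝ} (hf : Measurable f) (hf0 : ∀ x, 0 ≤ f x)
    (hμ : (μ : Measure X) = m.withDensity fun x => ENNReal.ofReal (f x))
    (hi : Integrable (fun x => f x * Real.log (f x)) m) :
    relEntropy m μ = ((∫ x, f x * Real.log (f x) ∂m : ℝ) : EReal) := by
  have hac : (μ : Measure X) ≪ m := hμ ▸ withDensity_absolutelyContinuous _ _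
  have hd : (fun x => ((μ : Measure X).rnDeriv m x).toReal *
      Real.log ((μ : Measure X).rnDeriv m x).toReal) =ᵐ[m] fun x => f x * Real.log (f x) := by
    have h := Measure.rnDeriv_withDensity m (f := fun x => ENNReal.ofReal (f x))
      hf.ennreal_ofReal
    rw [← hμ] at h
    filter_upwards [h] with x hx
    rw [hx, ENNReal.toReal_ofReal (hf0 x)]
  rw [relEntropy, if_pos ⟨hac, hi.congr hd.symm⟩, integral_congr_ae hd]

end Measurable

theorem integral_sub_le_of_forall_continuous {X : Type*} [MetricSpace X] [MeasurableSpace X]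
    [BorelSpace X] {m : Measure X} [IsFiniteMeasure m] {μ : ProbabilityMeasure X} {r : ℝ}
    (H : ∀ g : X →ᵇ ℝ,
      ∫ x, g x ∂(μ : Measure X) - ∫ x, Real.exp (g x - 1) ∂m ≤ r)
    {g : X → ℝ} (hg : Measurable g) {C : ℝ} (hC : ∀ x, |g x| ≤ C) :
    ∫ x, g x ∂(μ : Measure X) - ∫ x, Real.exp (g x - 1) ∂m ≤ r := by
  -- Approximation in $L^1(\mu+\mathfrak m)$ gives a single sequence converging almost everywhere
  -- for both measures; clipping it to $[-C,C]$ allows dominated convergence in both integrals.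
  set σ : Measure X := (μ : Measure X) + m with hσ
  have hgL : MemLp g 1 σ := memLp_one_iff_integrable.2 (integrable_of_abs_le hg hC)
  choose h hh _ using fun n : ℕ => hgL.exists_boundedContinuous_eLpNorm_sub_le ENNReal.one_ne_top
    (ε := ENNReal.ofReal (1 / (n + 1))) (by simpa using Nat.cast_add_one_pos n)
  have hlim0 : Tendsto (fun n => eLpNorm (⇑(h n) - g) 1 σ) atTop (𝓝 0) := by
    refine tendsto_of_tendsto_of_tendsto_of_le_of_le tendsto_const_nhds
      (h := fun n : ℕ => ENNReal.ofReal (1 / (n + 1))) ?_ (fun _ => zero_le) fun n => ?_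
    · simpa [Function.comp_def] using (ENNReal.continuous_ofReal.tendsto 0).comp
        (tendsto_one_div_add_atTop_nhds_zero_nat (𝕜 := ℝ))
    · dsimp only; rw [eLpNorm_sub_comm]; exact hh n
  obtain ⟨ns, -, hns⟩ := (tendstoInMeasure_of_tendsto_eLpNorm (one_ne_zero)
    (fun n => (h n).continuous.measurable.aestronglyMeasurable) hg.aestronglyMeasurable
    hlim0).exists_seq_tendsto_ae
  have hC0 : ∀ x : X, 0 ≤ C := fun x => (abs_nonneg _).trans (hC x)
  set k : ℕ → X →ᵇ ℝ := fun n => BoundedContinuousFunction.ofNormedAddCommGroup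
    (fun x => max (-C) (min (h (ns n) x) C)) (by fun_prop) C (fun x => by
      rw [Real.norm_eq_abs, abs_le]
      exact ⟨le_max_left _ _, max_le (by linarith [hC0 x]) (min_le_right _ _)⟩) with hk
  have hkC : ∀ n x, |k n x| ≤ C := fun n x => by
    rw [abs_le]
    exact ⟨le_max_left _ _, max_le (by linarith [hC0 x]) (min_le_right _ _)⟩
  have hkt : ∀ᵐ x ∂σ, Tendsto (fun n => k n x) atTop (𝓝 (g x)) := by
    filter_upwards [hns] with x hx
    have := (tendsto_const_nhds (x := -C)).max (hx.min (tendsto_const_nhds (x := C)))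
    rwa [min_eq_left (abs_le.1 (hC x)).2, max_eq_right (abs_le.1 (hC x)).1] at this
  have hμσ : (μ : Measure X) ≪ σ := Measure.AbsolutelyContinuous.rfl.add_right _
  have hmσ : m ≪ σ := Measure.le_add_left le_rfl |>.absolutelyContinuous
  have hlim1 : Tendsto (fun n => ∫ x, k n x ∂(μ : Measure X)) atTop
      (𝓝 (∫ x, g x ∂(μ : Measure X))) :=
    tendsto_integral_of_dominated_convergence (fun _ => C)
      (fun n => (k n).continuous.measurable.aestronglyMeasurable) (integrable_const _)
      (fun n => ae_of_all _ (hkC n)) (hμσ.ae_le hkt)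
  have hlim2 : Tendsto (fun n => ∫ x, Real.exp (k n x - 1) ∂m) atTop
      (𝓝 (∫ x, Real.exp (g x - 1) ∂m)) := by
    refine tendsto_integral_of_dominated_convergence (fun _ => Real.exp (C - 1))
      (fun n => ?_) (integrable_const _) (fun n => ae_of_all _ fun x => ?_) (hmσ.ae_le ?_)
    · exact (Real.continuous_exp.comp
        ((k n).continuous.sub continuous_const)).measurable.aestronglyMeasurable
    · rw [Real.norm_eq_abs, Real.abs_exp, Real.exp_le_exp]
      linarith [(abs_le.1 (hkC n x)).2]
    · filter_upwards [hkt] with x hx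
      exact (Real.continuous_exp.tendsto _).comp (hx.sub_const 1)
  exact le_of_tendsto' (hlim1.sub hlim2) fun n => H (k n)

theorem relEntropy_le_of_forall_continuous {X : Type*} [MetricSpace X] [MeasurableSpace X]
    [BorelSpace X] {m : Measure X} [IsFiniteMeasure m] {μ : ProbabilityMeasure X} {r : ℝ}
    (H : ∀ g : X →ᵇ ℝ,
      ∫ x, g x ∂(μ : Measure X) - ∫ x, Real.exp (g x - 1) ∂m ≤ r) :
    relEntropy m μ ≤ r :=
  relEntropy_le_of_forall_integral_sub_le fun _ hg ⟨_, hC⟩ =>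
    integral_sub_le_of_forall_continuous H hg hC

/-! ### Wasserstein distance under small displacements. -/

theorem edist_sq_le_add {X Z : Type*} [MetricSpace X] [MetricSpace Z] {x x' : X} {z z' : Z}
    {η D : ℝ} (hη : 0 ≤ η) (hD : dist x x' ≤ D) (h : dist z z' ≤ dist x x' + η) :
    edist z z' ^ 2 ≤ edist x x' ^ 2 + ENNReal.ofReal (2 * D * η + η ^ 2) := by
  rw [edist_dist, edist_dist, ← ENNReal.ofReal_pow dist_nonneg, ← ENNReal.ofReal_pow dist_nonneg,
    ← ENNReal.ofReal_add (by positivity)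
      (by have := dist_nonneg.trans hD; positivity)]
  refine ENNReal.ofReal_le_ofReal ?_
  have h1 : dist z z' ^ 2 ≤ (dist x x' + η) ^ 2 := pow_le_pow_left₀ dist_nonneg h 2
  nlinarith [mul_le_mul_of_nonneg_right hD hη]

/-- Transporting the first measure by a Markov kernel and the second one by a map changes the
squared Wasserstein distance by at most `c` if it changes squared distances by at most `c`. -/
theorem wassersteinSq_comp_map_le {X Z : Type*} [MetricSpace X] [MeasurableSpace X]
    [MetricSpace Z] [SecondCountableTopology Z] [MeasurableSpace Z] [BorelSpace Z]
    (κ : Kernel X Z) [IsMarkovKernel κ] {ψ : X → Z} (hψ : Measurable ψ) {c : ℝ≥0∞}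
    (h : ∀ x x', ∀ᵐ z ∂κ x, edist z (ψ x') ^ 2 ≤ edist x x' ^ 2 + c)
    {μ ν : ProbabilityMeasure X} {μ' ν' : ProbabilityMeasure Z}
    (hμ : (μ' : Measure Z) = (μ : Measure X).bind κ)
    (hν : (ν' : Measure Z) = (ν : Measure X).map ψ) :
    wassersteinSq μ' ν' ≤ wassersteinSq μ ν + c := by
  unfold wassersteinSq
  simp only [ENNReal.iInf_add]
  refine le_iInf₂ fun π hπ => ?_
  have hπp : IsProbabilityMeasure π := by
    refine ⟨?_⟩
    rw [← Measure.fst_univ, hπ.1]; exact measure_univ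
  -- A coupling is pushed forward by $(x,x')\mapsto\kappa(x)\otimes\delta_{\psi(x')}$.
  set G : Kernel (X × X) (Z × Z) :=
    (κ.comap Prod.fst measurable_fst) ×ₖ
      Kernel.deterministic (fun p : X × X => ψ p.2) (hψ.comp measurable_snd) with hG
  refine iInf₂_le_of_le (π.bind G) ⟨?_, ?_⟩ ?_
  · rw [hμ, ← hπ.1]
    ext s hs
    rw [Measure.fst_apply hs, Measure.bind_apply (measurable_fst hs) G.aemeasurable,
      Measure.bind_apply hs κ.aemeasurable, Measure.fst,
      lintegral_map (κ.measurable_coe hs) measurable_fst]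
    refine lintegral_congr fun p => ?_
    rw [hG, Kernel.prod_apply, ← Measure.fst_apply hs, Measure.fst_prod, Kernel.comap_apply]
  · rw [hν, ← hπ.2]
    ext s hs
    rw [Measure.snd_apply hs, Measure.bind_apply (measurable_snd hs) G.aemeasurable,
      Measure.map_apply hψ hs, Measure.snd_apply (hψ hs), ← lintegral_indicator_one
        (measurable_snd (hψ hs))]
    refine lintegral_congr fun p => ?_
    rw [hG, Kernel.prod_apply, ← Measure.snd_apply hs, Measure.snd_prod,
      Kernel.deterministic_apply, Measure.dirac_apply' _ hs]
    rfl
  · have hm : Measurable fun p : Z × Z => edist p.1 p.2 ^ 2 := measurable_edist.pow_const 2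
    rw [Measure.lintegral_bind G.aemeasurable hm.aemeasurable]
    have hconst : ∫⁻ p, edist p.1 p.2 ^ 2 ∂π + c = ∫⁻ p, (edist p.1 p.2 ^ 2 + c) ∂π := by
      rw [lintegral_add_right _ measurable_const, lintegral_const, measure_univ, mul_one]
    rw [hconst]
    refine lintegral_mono fun p => ?_
    rw [hG, Kernel.prod_apply, Kernel.deterministic_apply, Measure.prod_dirac,
      Kernel.comap_apply, lintegral_map hm (by fun_prop)]
    calc ∫⁻ z, edist z (ψ p.2) ^ 2 ∂κ p.1 ≤ ∫⁻ _, (edist p.1 p.2 ^ 2 + c) ∂κ p.1 :=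
          lintegral_mono_ae (h p.1 p.2)
      _ = edist p.1 p.2 ^ 2 + c := by rw [lintegral_const, measure_univ, mul_one]

/-! ### Lower semicontinuity of the Wasserstein distance on compact spaces. -/

section Compact

variable {Y : Type*} [MetricSpace Y] [CompactSpace Y] [MeasurableSpace Y] [BorelSpace Y]

theorem isClosed_setOf_lintegral_edist_sq_le (C : ℝ≥0∞) :
    IsClosed {π : ProbabilityMeasure (Y × Y) |
      ∫⁻ p, edist p.1 p.2 ^ 2 ∂(π : Measure (Y × Y)) ≤ C} := by
  set f : C(Y × Y, NNReal) := ⟨fun p => nndist p.1 p.2 ^ 2, by fun_prop⟩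
  have h := ProbabilityMeasure.continuous_lintegral_continuousMap (X := Y × Y) f
  have := isClosed_Iic.preimage h (t := Set.Iic C)
  convert this using 1
  ext π
  simp only [edist_nndist]
  rfl

theorem lowerSemicontinuous_wassersteinSq :
    LowerSemicontinuous fun p : ProbabilityMeasure Y × ProbabilityMeasure Y =>
      wassersteinSq p.1 p.2 := by
  rw [lowerSemicontinuous_iff_isClosed_preimage]
  intro C
  set F : ProbabilityMeasure (Y × Y) → ProbabilityMeasure Y × ProbabilityMeasure Y := fun π =>
    (π.map (f := Prod.fst) measurable_fst.aemeasurable,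
      π.map (f := Prod.snd) measurable_snd.aemeasurable) with hF
  have hFc : Continuous F := (ProbabilityMeasure.continuous_map continuous_fst).prodMk
    (ProbabilityMeasure.continuous_map continuous_snd)
  -- Taking all $C'>C$ avoids the existence of optimal couplings: each set on the right is the
  -- continuous image of a compact set of couplings.
  have hset : (fun p : ProbabilityMeasure Y × ProbabilityMeasure Y =>
      wassersteinSq p.1 p.2) ⁻¹' Set.Iic C =
      ⋂ C' ∈ Set.Ioi C, F '' {π : ProbabilityMeasure (Y × Y) |
        ∫⁻ p, edist p.1 p.2 ^ 2 ∂(π : Measure (Y × Y)) ≤ C'} := by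
    ext ⟨μ, ν⟩
    simp only [Set.mem_preimage, Set.mem_Iic, Set.mem_iInter, Set.mem_Ioi, Set.mem_image,
      Set.mem_ofPred_eq]
    constructor
    · intro h C' hC'
      obtain ⟨π, hπ⟩ := iInf_lt_iff.1 (h.trans_lt hC')
      obtain ⟨⟨h1, h2⟩, h3⟩ := iInf_lt_iff.1 hπ
      have hπp : IsProbabilityMeasure π := by
        refine ⟨?_⟩
        rw [← Measure.fst_univ, h1]; exact measure_univ
      refine ⟨⟨π, hπp⟩, h3.le, ?_⟩
      refine Prod.ext (Subtype.ext ?_) (Subtype.ext ?_)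
      · exact h1
      · exact h2
    · intro h
      refine le_of_forall_gt_imp_ge_of_dense fun C' hC' => ?_
      obtain ⟨π, h1, h2⟩ := h C' hC'
      refine (iInf₂_le (π : Measure (Y × Y)) ⟨?_, ?_⟩).trans h1
      · exact congrArg (fun q : ProbabilityMeasure Y × ProbabilityMeasure Y =>
          (q.1 : Measure Y)) h2
      · exact congrArg (fun q : ProbabilityMeasure Y × ProbabilityMeasure Y =>
          (q.2 : Measure Y)) h2
  rw [hset]
  exact isClosed_biInter fun C' _ =>
    ((isClosed_setOf_lintegral_edist_sq_le C').isCompact.image hFc).isClosed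

theorem lowerSemicontinuous_wassersteinSq_right (μ : ProbabilityMeasure Y) :
    LowerSemicontinuous fun ν : ProbabilityMeasure Y => wassersteinSq μ ν :=
  lowerSemicontinuous_wassersteinSq.comp (by fun_prop : Continuous fun ν => (μ, ν))

end Compact

/-! ### Weak convergence and partitions into cells with null frontier. -/

/-- The portmanteau theorem for the normalized measures, multiplied by the convergence of total
masses; normalizing requires a nonzero limit. -/
theorem tendsto_measureReal_of_null_frontier {ι Y : Type*} [MetricSpace Y] [MeasurableSpace Y]
    [BorelSpace Y] [Nonempty Y] {L : Filter ι} {σ : ι → Measure Y} [∀ i, IsFiniteMeasure (σ i)]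
    {m : Measure Y} [IsFiniteMeasure m] (hm : m ≠ 0)
    (h : ∀ g : Y →ᵇ ℝ, Tendsto (fun i => ∫ y, g y ∂σ i) L (𝓝 (∫ y, g y ∂m)))
    {A : Set Y} (hA : m (frontier A) = 0) :
    Tendsto (fun i => (σ i).real A) L (𝓝 (m.real A)) := by
  set σ' : ι → FiniteMeasure Y := fun i => ⟨σ i, inferInstance⟩
  set m' : FiniteMeasure Y := ⟨m, inferInstance⟩
  have hm' : m' ≠ 0 := fun h0 => hm (congrArg Subtype.val h0)
  have ht : Tendsto σ' L (𝓝 m') := FiniteMeasure.tendsto_of_forall_integral_tendsto h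
  have h1 := FiniteMeasure.tendsto_normalize_of_tendsto ht hm'
  have hn : m'.normalize (frontier A) = 0 := by
    rw [m'.normalize_eq_of_nonzero hm']
    have : m' (frontier A) = 0 := by
      change (m (frontier A)).toNNReal = 0
      rw [hA]; rfl
    rw [this, mul_zero]
  have h2 := (ht.mass).mul (ProbabilityMeasure.tendsto_measure_of_null_frontier_of_tendsto h1 hn)
  simp only [← FiniteMeasure.self_eq_mass_mul_normalize] at h2
  exact (NNReal.continuous_coe.tendsto _).comp h2

/-- A compact space has a finite Borel partition into cells of small diameter and null frontier. -/
theorem exists_measurable_finite_partition {Y : Type*} [MetricSpace Y] [CompactSpace Y]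
    [MeasurableSpace Y] [BorelSpace Y] (m : Measure Y) [IsFiniteMeasure m] {δ : ℝ} (hδ : 0 < δ) :
    ∃ (t : Finset Y) (c : Y → (t → Bool)), Measurable c ∧
      (∀ j, m (frontier (c ⁻¹' {j})) = 0) ∧ ∀ y y', c y = c y' → dist y y' ≤ δ := by
  classical
  have hr : ∀ y : Y, ∃ r ∈ Set.Ioo (0 : ℝ) (δ / 2), m (frontier (Metric.ball y r)) = 0 := fun y => by
    obtain ⟨r, hr, h⟩ := exists_null_frontier_thickening m {y} (half_pos hδ)
    exact ⟨r, hr, by rwa [Metric.thickening_singleton] at h⟩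
  choose r hr hfr using hr
  obtain ⟨t, ht⟩ := isCompact_univ.elim_finite_subcover (fun y => Metric.ball y (r y))
    (fun _ => Metric.isOpen_ball)
    (fun y _ => Set.mem_iUnion.2 ⟨y, Metric.mem_ball_self (hr y).1⟩)
  -- The label of a point records which balls of the finite cover contain it, so cells are the atoms
  -- of the algebra generated by these balls.
  set c : Y → (t → Bool) := fun y p => decide (y ∈ Metric.ball (p : Y) (r p)) with hc
  refine ⟨t, c, measurable_pi_iff.2 fun p => ?_, fun j => ?_, fun y y' h => ?_⟩
  · refine measurable_to_bool ?_
    have : (fun y => c y p) ⁻¹' {true} = Metric.ball (p : Y) (r p) := by ext y; simp [hc]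
    rw [this]
    exact Metric.isOpen_ball.measurableSet
  · have hsub : frontier (c ⁻¹' {j}) ⊆ ⋃ p : t, frontier (Metric.ball (p : Y) (r p)) := by
      intro y hy
      by_contra hne
      simp only [Set.mem_iUnion, not_exists] at hne
      have hev : ∀ᶠ y' in 𝓝 y, ∀ p : t, c y' p = c y p := by
        refine eventually_all.2 fun p => ?_
        by_cases hyp : y ∈ Metric.ball (p : Y) (r p)
        · filter_upwards [Metric.isOpen_ball.mem_nhds hyp] with y' hy'
          simp only [hc]; rw [decide_eq_true hyp, decide_eq_true hy']
        · have hcl : y ∉ closure (Metric.ball (p : Y) (r p)) := fun hcl =>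
            hne p ⟨hcl, by rwa [Metric.isOpen_ball.interior_eq]⟩
          filter_upwards [isClosed_closure.isOpen_compl.mem_nhds hcl] with y' hy'
          have : y' ∉ Metric.ball (p : Y) (r p) := fun h => hy' (subset_closure h)
          simp only [hc]; rw [decide_eq_false hyp, decide_eq_false this]
      by_cases hyj : c y = j
      · refine hy.2 (mem_interior_iff_mem_nhds.2 ?_)
        filter_upwards [hev] with y' hy'
        exact (funext hy').trans hyj
      · obtain ⟨y', h1, h2⟩ := ((mem_closure_iff_frequently.1 hy.1).and_eventually hev).exists
        exact hyj ((funext h2).symm.trans h1)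
    exact measure_mono_null hsub (measure_iUnion_null fun p => hfr p)
  · have := ht (Set.mem_univ y)
    simp only [Set.mem_iUnion] at this
    obtain ⟨p, hp, hyp⟩ := this
    have h1 := congrFun h ⟨p, hp⟩
    have h2 : y' ∈ Metric.ball p (r p) := by
      simp only [hc] at h1
      rw [decide_eq_true hyp] at h1
      exact of_decide_eq_true h1.symm
    have h3 := (hr p).2
    rw [Metric.mem_ball] at hyp h2
    have := dist_triangle_right y y' p
    linarith

/-! ### Cellwise redistribution of measures and its entropy. -/

open scoped Classical in
/-- The measure `m` conditioned on `B`, or a Dirac mass at `z` if `B` is null. -/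
noncomputable def condOrDirac {Z : Type*} [MeasurableSpace Z] (m : Measure Z) (B : Set Z) (z : Z) :
    Measure Z :=
  if m B = 0 then Measure.dirac z else m[|B]

/-- The entropy of the distribution of a finite partition with respect to another one. -/
noncomputable def cellEntropy {J : Type*} [Fintype J] (p q : J → ℝ) : ℝ := ∑ j, q j * (p j / q j * Real.log (p j / q j))

theorem tendsto_cellEntropy {ι J : Type*} [Fintype J] {L : Filter ι} {p : J → ℝ} {q : J → ℝ} {r : ι → J → ℝ}
    (hr : ∀ j, Tendsto (fun i => r i j) L (𝓝 (q j))) (h : ∀ j, q j = 0 → p j = 0) :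
    Tendsto (fun i => cellEntropy p (r i)) L (𝓝 (cellEntropy p q)) := by
  refine tendsto_finsetSum _ fun j _ => ?_
  by_cases hj : q j = 0
  · simp only [h j hj, zero_div, zero_mul, mul_zero]
    exact tendsto_const_nhds
  · have h1 : Tendsto (fun i => p j / r i j) L (𝓝 (p j / q j)) :=
      tendsto_const_nhds.div (hr j) hj
    exact (hr j).mul ((Real.continuous_mul_log.tendsto _).comp h1)

section Cells

variable {W Z J : Type*} [MeasurableSpace W] [MeasurableSpace Z] [Fintype J] [MeasurableSpace J]
  [MeasurableSingletonClass J]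

instance (m : Measure Z) [IsFiniteMeasure m] (B : Set Z) (z : Z) :
    IsProbabilityMeasure (condOrDirac m B z) := by
  unfold condOrDirac
  split_ifs with h
  · infer_instance
  · exact cond_isProbabilityMeasure h

/-- The kernel sending a point of the cell of index `j` in `W` to the measure `m` conditioned on
the cell of index `j` in `Z`. -/
noncomputable def cellKernel {c : W → J} (hc : Measurable c) (m : Measure Z) (b : Z → J)
    (z : J → Z) : Kernel W Z :=
  (Kernel.ofFunOfCountable fun j => condOrDirac m (b ⁻¹' {j}) (z j)).comap c hc

variable {c : W → J} {hc : Measurable c} {m : Measure Z} {b : Z → J}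
  {z : J → Z}

theorem cellKernel_apply (w : W) :
    cellKernel hc m b z w = condOrDirac m (b ⁻¹' {c w}) (z (c w)) := rfl

instance [IsFiniteMeasure m] : IsMarkovKernel (cellKernel hc m b z) :=
  ⟨fun w => by rw [cellKernel_apply]; infer_instance⟩

theorem ae_cellKernel (hb : Measurable b) {p : Z → Prop} (w : W) (h1 : ∀ x, b x = c w → p x)
    (h2 : p (z (c w))) (hp : MeasurableSet {x | p x}) : ∀ᵐ x ∂cellKernel hc m b z w, p x := by
  rw [cellKernel_apply, condOrDirac]
  split_ifs with h
  · exact (ae_dirac_iff hp).2 h2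
  · filter_upwards [ae_cond_mem (hb (measurableSet_singleton (c w)))] with x hx using h1 x hx

theorem bind_cellKernel (μ : Measure W) [IsFiniteMeasure μ] :
    μ.bind (cellKernel hc m b z) =
      ∑ j, μ (c ⁻¹' {j}) • condOrDirac m (b ⁻¹' {j}) (z j) := by
  ext s hs
  rw [Measure.bind_apply hs (Kernel.aemeasurable _)]
  have : ∀ w, cellKernel hc m b z w s = (fun j => condOrDirac m (b ⁻¹' {j}) (z j) s) (c w) :=
    fun w => rfl
  rw [lintegral_congr this, ← lintegral_map (f := fun j => condOrDirac m (b ⁻¹' {j}) (z j) s)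
    (measurable_of_countable _) hc, lintegral_fintype]
  simp only [Measure.coe_finsetSum, Finset.sum_apply, Measure.smul_apply, smul_eq_mul,
    Measure.map_apply hc (measurableSet_singleton _), mul_comm]

/-- If `m` charges the cells that `μ` charges, then the null cells do not matter. -/
theorem bind_cellKernel_eq_sum_cond (μ : Measure W) [IsFiniteMeasure μ]
    (h : ∀ j, m (b ⁻¹' {j}) = 0 → μ (c ⁻¹' {j}) = 0) :
    μ.bind (cellKernel hc m b z) = ∑ j, μ (c ⁻¹' {j}) • m[|b ⁻¹' {j}] := by
  rw [bind_cellKernel]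
  refine Finset.sum_congr rfl fun j _ => ?_
  rw [condOrDirac]
  split_ifs with hj
  · rw [h j hj, zero_smul, zero_smul]
  · rfl

variable [IsFiniteMeasure m]

theorem bind_cellKernel_apply_preimage (hb : Measurable b) (μ : Measure W) [IsFiniteMeasure μ]
    (h : ∀ j, m (b ⁻¹' {j}) = 0 → μ (c ⁻¹' {j}) = 0) (j : J) :
    μ.bind (cellKernel hc m b z) (b ⁻¹' {j}) = μ (c ⁻¹' {j}) := by
  rw [bind_cellKernel_eq_sum_cond μ h, Measure.coe_finsetSum, Finset.sum_apply,
    Finset.sum_eq_single j]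
  · rw [Measure.smul_apply, smul_eq_mul]
    by_cases hj : m (b ⁻¹' {j}) = 0
    · rw [h j hj, zero_mul]
    · rw [cond_apply_self hj (measure_ne_top _ _), mul_one]
  · intro i _ hij
    have : b ⁻¹' {i} ∩ b ⁻¹' {j} = ∅ := by
      ext x; simp only [Set.mem_inter_iff, Set.mem_preimage, Set.mem_singleton_iff,
        Set.mem_empty_iff_false, iff_false]
      rintro ⟨rfl, h⟩; exact hij h
    rw [Measure.smul_apply, cond_apply (hb (measurableSet_singleton i)), this]
    simp
  · simp

/-- Redistributing a measure cellwise and back recovers the measure. -/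
theorem bind_cellKernel_bind_cellKernel (hb : Measurable b) (μ : Measure W) [IsFiniteMeasure μ]
    (h : ∀ j, m (b ⁻¹' {j}) = 0 → μ (c ⁻¹' {j}) = 0) (w : J → W) :
    (μ.bind (cellKernel hc m b z)).bind (cellKernel hb μ c w) = μ := by
  have : IsFiniteMeasure (μ.bind (cellKernel hc m b z)) := inferInstance
  rw [bind_cellKernel_eq_sum_cond (m := μ)]
  · simp_rw [bind_cellKernel_apply_preimage hb μ h]
    exact sum_meas_smul_cond_fiber hc μ
  · intro j hj
    rw [bind_cellKernel_apply_preimage hb μ h, hj]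

/-- The cellwise redistribution of a measure has a cellwise constant density. -/
theorem bind_cellKernel_eq_withDensity (hb : Measurable b) (μ : Measure W) [IsFiniteMeasure μ]
    (h : ∀ j, m (b ⁻¹' {j}) = 0 → μ (c ⁻¹' {j}) = 0) :
    μ.bind (cellKernel hc m b z) = m.withDensity fun x =>
      ENNReal.ofReal (μ.real (c ⁻¹' {b x}) / m.real (b ⁻¹' {b x})) := by
  rw [bind_cellKernel_eq_sum_cond μ h]
  ext s hs
  rw [withDensity_apply _ hs, ← lintegral_map (μ := m.restrict s) (g := b)
    (f := fun j => ENNReal.ofReal (μ.real (c ⁻¹' {j}) / m.real (b ⁻¹' {j})))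
    (measurable_of_countable _) hb, lintegral_fintype]
  simp only [Measure.coe_finsetSum, Finset.sum_apply, Measure.smul_apply, smul_eq_mul]
  refine Finset.sum_congr rfl fun j _ => ?_
  have hbj := hb (measurableSet_singleton j)
  rw [Measure.map_apply hb (measurableSet_singleton j), Measure.restrict_apply hbj,
    cond_apply hbj, ← mul_assoc]
  by_cases hj : m (b ⁻¹' {j}) = 0
  · rw [h j hj, measure_mono_null Set.inter_subset_left hj]; simp
  · have hpos : 0 < m.real (b ⁻¹' {j}) := ENNReal.toReal_pos hj (measure_ne_top _ _)
    rw [ENNReal.ofReal_div_of_pos hpos, ofReal_measureReal, ofReal_measureReal, div_eq_mul_inv]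

theorem relEntropy_bind_cellKernel (hb : Measurable b) (μ : Measure W) [IsFiniteMeasure μ]
    (h : ∀ j, m (b ⁻¹' {j}) = 0 → μ (c ⁻¹' {j}) = 0) {μ' : ProbabilityMeasure Z}
    (hμ' : (μ' : Measure Z) = μ.bind (cellKernel hc m b z)) :
    relEntropy m μ' =
      (cellEntropy (fun j => μ.real (c ⁻¹' {j})) (fun j => m.real (b ⁻¹' {j})) : ℝ) := by
  set f : J → ℝ := fun j => μ.real (c ⁻¹' {j}) / m.real (b ⁻¹' {j}) with hf
  have hfi : Integrable (fun j => f j * Real.log (f j)) (m.map b) := Integrable.of_finite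
  rw [relEntropy_eq_of_withDensity (f := f ∘ b) ((measurable_of_countable f).comp hb)
    (fun x => div_nonneg measureReal_nonneg measureReal_nonneg)
    (hμ'.trans (bind_cellKernel_eq_withDensity hb μ h)) (hfi.comp_measurable hb)]
  congr 1
  rw [show (fun x => (f ∘ b) x * Real.log ((f ∘ b) x)) =
      fun x => (fun j => f j * Real.log (f j)) (b x) from rfl,
    ← integral_map (f := fun j => f j * Real.log (f j)) hb.aemeasurable
    (measurable_of_countable _).aestronglyMeasurable, integral_fintype hfi]
  refine Finset.sum_congr rfl fun j _ => ?_
  rw [map_measureReal_apply hb (measurableSet_singleton j), smul_eq_mul]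

/-- Coarse-graining does not increase entropy: this is the easy Donsker--Varadhan inequality for
test functions constant on cells. -/
theorem cellEntropy_le {m : Measure W} [IsFiniteMeasure m] {μ : ProbabilityMeasure W}
    {e : ℝ} (he : relEntropy m μ = e) (hc : Measurable c) :
    cellEntropy (fun j => (μ : Measure W).real (c ⁻¹' {j})) (fun j => m.real (c ⁻¹' {j})) ≤ e := by
  classical
  have hac : (μ : Measure W) ≪ m := by
    unfold relEntropy at he
    split_ifs at he with h
    exacts [h.1, absurd he (by simp)]
  set p : J → ℝ := fun j => (μ : Measure W).real (c ⁻¹' {j}) with hp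
  set q : J → ℝ := fun j => m.real (c ⁻¹' {j}) with hq
  have hp0 : ∀ j, 0 ≤ p j := fun j => measureReal_nonneg
  have hq0 : ∀ j, 0 ≤ q j := fun j => measureReal_nonneg
  have hpq : ∀ j, q j = 0 → p j = 0 := fun j hj => by
    rw [hp]; dsimp only
    rw [hq] at hj; dsimp only at hj
    rw [measureReal_eq_zero_iff] at hj ⊢
    exact hac hj
  have key : ∀ n : ℕ, cellEntropy p q - (∑ j, q j) * Real.exp (-(n : ℝ) - 1) ≤ e := by
    intro n
    -- The optimal value is $1+\ln(p_j/q_j)$, which should be $-\infty$ where $p_j=0$. Replacing it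
    -- by $-n$ costs at most $q_j e^{-n-1}$ per cell.
    set g : J → ℝ := fun j => if p j / q j = 0 then -(n : ℝ) else 1 + Real.log (p j / q j) with hg
    obtain ⟨C, hC⟩ : ∃ C, ∀ j, |g j| ≤ C := ⟨∑ j, |g j|, fun j =>
      Finset.single_le_sum (f := fun j => |g j|) (fun _ _ => abs_nonneg _) (Finset.mem_univ j)⟩
    have h := integral_sub_integral_exp_le_of_relEntropy_eq he (g := g ∘ c)
      ((measurable_of_countable g).comp hc) (fun x => hC (c x))
    have h1 : ∫ x, (g ∘ c) x ∂(μ : Measure W) = ∑ j, p j * g j := by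
      have := integral_map (μ := (μ : Measure W)) (f := g) hc.aemeasurable
        (measurable_of_countable _).aestronglyMeasurable
      rw [integral_fintype Integrable.of_finite] at this
      simp only [map_measureReal_apply hc (measurableSet_singleton _), smul_eq_mul] at this
      exact this.symm
    have h2 : ∫ x, Real.exp ((g ∘ c) x - 1) ∂m = ∑ j, q j * Real.exp (g j - 1) := by
      have := integral_map (μ := m) (f := fun j => Real.exp (g j - 1)) hc.aemeasurable
        (measurable_of_countable _).aestronglyMeasurable
      rw [integral_fintype Integrable.of_finite] at this
      simp only [map_measureReal_apply hc (measurableSet_singleton _), smul_eq_mul] at this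
      exact this.symm
    rw [h1, h2] at h
    refine le_trans ?_ h
    rw [cellEntropy, Finset.sum_mul, ← Finset.sum_sub_distrib, ← Finset.sum_sub_distrib]
    refine Finset.sum_le_sum fun j _ => ?_
    by_cases hj : p j / q j = 0
    · have hpj : p j = 0 := by
        rcases div_eq_zero_iff.1 hj with h | h
        exacts [h, hpq j h]
      simp [hg, hpj]
    · have hqj : q j ≠ 0 := fun h => hj (by rw [h, div_zero])
      have hpos : 0 < p j / q j := lt_of_le_of_ne (div_nonneg (hp0 j) (hq0 j)) (Ne.symm hj)
      have hgj : g j = 1 + Real.log (p j / q j) := if_neg hj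
      rw [hgj, add_sub_cancel_left, Real.exp_log hpos]
      have h3 : q j * (p j / q j) = p j := by field_simp
      rw [← mul_assoc, h3]
      nlinarith [mul_nonneg (hq0 j) (Real.exp_nonneg (-(n : ℝ) - 1))]
  have hlim : Tendsto (fun n : ℕ => cellEntropy p q - (∑ j, q j) * Real.exp (-(n : ℝ) - 1)) atTop
      (𝓝 (cellEntropy p q - (∑ j, q j) * 0)) := by
    refine tendsto_const_nhds.sub (tendsto_const_nhds.mul (Real.tendsto_exp_atBot.comp ?_))
    exact tendsto_atBot_add_const_right _ _
      (tendsto_neg_atTop_atBot.comp tendsto_natCast_atTop_atTop)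
  rw [mul_zero, sub_zero] at hlim
  exact le_of_tendsto' hlim key

end Cells

/-! ### Finitely supported measures on the space of probability measures. -/

/-- A probability measure is determined by its values on a countable generating π-system, so a
singleton is a countable intersection of measurable conditions. This makes the atoms of $\Omega$
measurable. -/
instance {X : Type*} [TopologicalSpace X] [SecondCountableTopology X] [MeasurableSpace X]
    [BorelSpace X] : MeasurableSingletonClass (ProbabilityMeasure X) := by
  refine ⟨fun μ => ?_⟩
  set b := TopologicalSpace.countableBasis X
  set C : Set (Set X) := (fun t => ⋂₀ t) '' {t : Set (Set X) | t.Finite ∧ t ⊆ b} with hC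
  have hCc : C.Countable :=
    (Set.countable_ofPred_finite_subset (TopologicalSpace.countable_countableBasis X)).image _
  have hCo : ∀ A ∈ C, MeasurableSet A := by
    rintro _ ⟨t, ⟨htf, htb⟩, rfl⟩
    exact MeasurableSet.sInter htf.countable fun A hA =>
      (TopologicalSpace.isOpen_of_mem_countableBasis (htb hA)).measurableSet
  have hpi : IsPiSystem C := by
    rintro _ ⟨t, ⟨htf, htb⟩, rfl⟩ _ ⟨u, ⟨huf, hub⟩, rfl⟩ _
    exact ⟨t ∪ u, ⟨htf.union huf, Set.union_subset htb hub⟩, Set.sInter_union t u⟩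
  have hgen : ‹MeasurableSpace X› = MeasurableSpace.generateFrom C := by
    refine le_antisymm ?_ (MeasurableSpace.generateFrom_le hCo)
    rw [BorelSpace.measurable_eq (α := X),
      (TopologicalSpace.isBasis_countableBasis X).borel_eq_generateFrom]
    refine MeasurableSpace.generateFrom_mono fun A hA => ?_
    exact ⟨{A}, ⟨Set.finite_singleton A, Set.singleton_subset_iff.2 hA⟩, Set.sInter_singleton A⟩
  have hset : ({μ} : Set (ProbabilityMeasure X)) =
      ⋂ A ∈ C, (fun ν : ProbabilityMeasure X => (ν : Measure X) A) ⁻¹' {(μ : Measure X) A} := by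
    ext ν
    simp only [Set.mem_singleton_iff, Set.mem_iInter, Set.mem_preimage]
    refine ⟨fun h A _ => by rw [h], fun h => Subtype.ext ?_⟩
    exact (ext_of_generate_finite (μ := (μ : Measure X)) C hgen hpi
      (fun A hA => (h A hA).symm) (by simp)).symm
  rw [hset]
  exact MeasurableSet.biInter hCc fun A hA =>
    ((Measure.measurable_coe (hCo A hA)).comp measurable_subtype_coe) (measurableSet_singleton _)

theorem relEntropy_ne_bot {X : Type*} [MeasurableSpace X] (m : Measure X)
    (μ : ProbabilityMeasure X) : relEntropy m μ ≠ ⊥ := by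
  unfold relEntropy
  split_ifs <;> simp

section Discrete

variable {α : Type*} [MeasurableSpace α] [MeasurableSingletonClass α]

/-- Only atoms of positive mass are kept, so that infinite entropy at any one of them makes the mean
entropy infinite. -/
theorem exists_finset_eq_sum_smul_dirac {Ω : Measure α}
    (h : ∃ S : Set α, S.Finite ∧ ∀ᵐ x ∂Ω, x ∈ S) :
    ∃ s : Finset α, (∀ x ∈ s, Ω {x} ≠ 0) ∧ Ω = ∑ x ∈ s, Ω {x} • Measure.dirac x := by
  classical
  obtain ⟨S, hS, hΩ⟩ := h
  refine ⟨hS.toFinset.filter fun x => Ω {x} ≠ 0, fun x hx => (Finset.mem_filter.1 hx).2, ?_⟩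
  ext A hA
  have h1 : Ω A = ∑ x ∈ hS.toFinset, Ω (A ∩ {x}) := by
    rw [← measure_biUnion_finset (fun x _ y _ hxy =>
      (Set.disjoint_singleton.2 hxy).mono Set.inter_subset_right Set.inter_subset_right)
      (fun x _ => hA.inter (measurableSet_singleton x))]
    refine measure_congr ?_
    filter_upwards [hΩ] with x hx
    change (x ∈ A) = (x ∈ ⋃ y ∈ hS.toFinset, A ∩ {y})
    simp [hx]
  rw [h1, Measure.coe_finsetSum, Finset.sum_apply, Finset.sum_filter]
  refine Finset.sum_congr rfl fun x _ => ?_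
  by_cases hxA : x ∈ A
  · rw [Set.inter_singleton_of_mem hxA]
    by_cases hx : Ω {x} = 0 <;> simp [hx, hxA]
  · rw [Set.inter_singleton_of_notMem hxA]
    simp [hxA]

variable {ι : Type*} (s : Finset ι) (w : ι → ℝ≥0∞) (x : ι → α)

theorem lintegral_sum_smul_dirac (F : α → ℝ≥0∞) :
    ∫⁻ a, F a ∂(∑ k ∈ s, w k • Measure.dirac (x k)) = ∑ k ∈ s, w k * F (x k) := by
  rw [lintegral_finsetSum_measure]
  simp [lintegral_smul_measure]

theorem sum_mul_ofReal_eq_ofReal_sum {s : Finset ι} {w : ι → ℝ≥0∞} (hw : ∀ k ∈ s, w k ≠ ∞)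
    (g : ι → ℝ) :
    ∑ k ∈ s, w k * ENNReal.ofReal (g k) =
      ENNReal.ofReal (∑ k ∈ s, (w k).toReal * max (g k) 0) := by
  rw [ENNReal.ofReal_sum_of_nonneg fun k _ => by positivity]
  refine Finset.sum_congr rfl fun k hk => ?_
  rw [ENNReal.ofReal_mul ENNReal.toReal_nonneg, ENNReal.ofReal_toReal (hw k hk),
    ENNReal.ofReal_max, ENNReal.ofReal_zero, max_eq_left zero_le]

theorem erealIntegral_sum_smul_dirac (hw : ∀ k ∈ s, w k ≠ ∞) {F : α → EReal} {f : ι → ℝ}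
    (hF : ∀ k ∈ s, F (x k) = f k) :
    erealIntegral (∑ k ∈ s, w k • Measure.dirac (x k)) F =
      ((∑ k ∈ s, (w k).toReal * f k : ℝ) : EReal) := by
  have h1 : ∑ k ∈ s, w k * (F (x k)).toENNReal = ∑ k ∈ s, w k * ENNReal.ofReal (f k) :=
    Finset.sum_congr rfl fun k hk => by rw [hF k hk, EReal.real_coe_toENNReal]
  have h2 : ∑ k ∈ s, w k * (-F (x k)).toENNReal = ∑ k ∈ s, w k * ENNReal.ofReal (-f k) :=
    Finset.sum_congr rfl fun k hk => by
      rw [hF k hk, ← EReal.coe_neg, EReal.real_coe_toENNReal]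
  have h0 : ∀ g : ι → ℝ, 0 ≤ ∑ k ∈ s, (w k).toReal * max (g k) 0 := fun g =>
    Finset.sum_nonneg fun k _ => by positivity
  rw [erealIntegral, lintegral_sum_smul_dirac, lintegral_sum_smul_dirac, h1, h2,
    sum_mul_ofReal_eq_ofReal_sum hw, sum_mul_ofReal_eq_ofReal_sum hw, EReal.coe_ennreal_ofReal,
    EReal.coe_ennreal_ofReal, max_eq_left (h0 _), max_eq_left (h0 _), ← EReal.coe_sub,
    ← Finset.sum_sub_distrib]
  congr 1
  refine Finset.sum_congr rfl fun k _ => ?_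
  rw [← mul_sub]
  congr 1
  rcases le_total (f k) 0 with h | h
  · rw [max_eq_right h, max_eq_left (neg_nonneg.2 h)]; ring
  · rw [max_eq_left h, max_eq_right (neg_nonpos.2 h)]; ring

theorem erealIntegral_sum_smul_dirac_eq_top (hw : ∀ k ∈ s, w k ≠ ∞) {F : α → EReal}
    (hbot : ∀ a, F a ≠ ⊥) {k : ι} (hk : k ∈ s) (hwk : w k ≠ 0) (hF : F (x k) = ⊤) :
    erealIntegral (∑ k ∈ s, w k • Measure.dirac (x k)) F = ⊤ := by
  rw [erealIntegral, lintegral_sum_smul_dirac, lintegral_sum_smul_dirac]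
  have h1 : ∑ k ∈ s, w k * (F (x k)).toENNReal = ∞ := by
    refine ENNReal.sum_eq_top.2 ⟨k, hk, ?_⟩
    rw [hF, EReal.toENNReal_top, ENNReal.mul_top hwk]
  have h2 : ∑ k ∈ s, w k * (-F (x k)).toENNReal ≠ ∞ := by
    refine ENNReal.sum_ne_top.2 fun k hk => ENNReal.mul_ne_top (hw k hk) ?_
    rw [Ne, EReal.toENNReal_eq_top_iff, EReal.neg_eq_top_iff]
    exact hbot _
  rw [h1, EReal.coe_ennreal_top]
  exact EReal.top_sub fun h => h2 (EReal.coe_ennreal_eq_top_iff.1 h)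

end Discrete

/-! ### Transfer of measures along approximations. -/

theorem IsApproximation.nonneg {X Y : Type*} [MetricSpace X] [MetricSpace Y] [Nonempty Y] {ε : ℝ}
    {φ : X → Y} (h : IsApproximation ε φ) : 0 ≤ ε := by
  obtain ⟨x, hx⟩ := h.2 (Classical.arbitrary Y)
  exact dist_nonneg.trans hx

theorem IsApproximation.dist_map_le {X Y : Type*} [MetricSpace X] [MetricSpace Y] {ε : ℝ}
    {φ : X → Y} (h : IsApproximation ε φ) (x x' : X) : dist (φ x) (φ x') ≤ dist x x' + ε := by
  linarith [(abs_le.1 (h.1 x x')).2]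

theorem IsApproximation.dist_le {X Y : Type*} [MetricSpace X] [MetricSpace Y] {ε : ℝ}
    {φ : X → Y} (h : IsApproximation ε φ) (x x' : X) : dist x x' ≤ dist (φ x) (φ x') + ε := by
  linarith [(abs_le.1 (h.1 x x')).1]

theorem compactSpace_of_isApproximation {X : ℕ → Type*} [∀ i, MetricSpace (X i)]
    [∀ i, CompactSpace (X i)] {Y : Type*} [MetricSpace Y] [CompleteSpace Y] {ε : ℕ → ℝ}
    {φ : ∀ i, X i → Y} (hε : Tendsto ε atTop (𝓝 0)) (h : ∀ i, IsApproximation (ε i) (φ i)) :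
    CompactSpace Y := by
  refine ⟨isCompact_iff_totallyBounded_isComplete.2
    ⟨Metric.totallyBounded_iff.2 fun η hη => ?_, isComplete_univ⟩⟩
  obtain ⟨i, hi⟩ := (hε.eventually_lt_const (half_pos (half_pos hη))).exists
  obtain ⟨t, ht, hcov⟩ := Metric.totallyBounded_iff.1 (isCompact_univ (X := X i)).totallyBounded
    (η / 4) (by positivity)
  refine ⟨φ i '' t, ht.image _, fun y _ => ?_⟩
  obtain ⟨x, hx⟩ := (h i).2 y
  obtain ⟨z, hz, hxz⟩ := Set.mem_iUnion₂.1 (hcov (Set.mem_univ x))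
  refine Set.mem_iUnion₂.2 ⟨φ i z, Set.mem_image_of_mem _ hz, ?_⟩
  rw [Metric.mem_ball] at hxz ⊢
  have h1 := (h i).dist_map_le x z
  have h2 := dist_triangle_left y (φ i z) (φ i x)
  linarith

/-- Transfer of probability measures along an approximation with respect to a partition into small
cells, with control of the entropy and of the Wasserstein distances. -/
theorem IsApproximation.exists_transfer {Y Z J : Type*} [MetricSpace Y] [CompactSpace Y]
    [MeasurableSpace Y] [BorelSpace Y] [Nonempty Y] [MetricSpace Z] [CompactSpace Z]
    [MeasurableSpace Z] [BorelSpace Z] [Fintype J] [MeasurableSpace J] [MeasurableSingletonClass J]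
    {ε δ D : ℝ} {φ : Z → Y} (hε : IsApproximation ε φ) (hφ : Measurable φ) (hδ : 0 ≤ δ)
    (hD : ∀ y y' : Y, dist y y' ≤ D) {c : Y → J} (hc : Measurable c)
    (hcδ : ∀ y y', c y = c y' → dist y y' ≤ δ) (m : Measure Z) [IsFiniteMeasure m] :
    ∃ T Ψ : ProbabilityMeasure Y → ProbabilityMeasure Z,
      (∀ μ ν, wassersteinSq (T μ) (Ψ ν) ≤ wassersteinSq μ ν +
        ENNReal.ofReal (2 * (D + ε) * (2 * δ + 3 * ε) + (2 * δ + 3 * ε) ^ 2)) ∧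
      ∀ μ : ProbabilityMeasure Y,
        (∀ j, m (c ∘ φ ⁻¹' {j}) = 0 → (μ : Measure Y) (c ⁻¹' {j}) = 0) →
        relEntropy m (T μ) = (cellEntropy (fun j => (μ : Measure Y).real (c ⁻¹' {j}))
          (fun j => m.real (c ∘ φ ⁻¹' {j})) : ℝ) ∧
        ∀ ν : ProbabilityMeasure Z, wassersteinSq μ (ν.map hφ.aemeasurable) ≤
          wassersteinSq (T μ) ν +
            ENNReal.ofReal (2 * (D + ε) * (2 * δ + 3 * ε) + (2 * δ + 3 * ε) ^ 2) := by
  have hε0 := hε.nonneg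
  have hb : Measurable (c ∘ φ) := hc.comp hφ
  -- A representative of each nonempty cell; the values on labels of empty cells are never evaluated
  -- at a label `c y`.
  set w : J → Y := Function.invFun c with hw
  have hcw : ∀ y, c (w (c y)) = c y := fun y => Function.invFun_eq ⟨y, rfl⟩
  choose z hz using fun j => hε.2 (w j)
  have hzy : ∀ y, dist (φ (z (c y))) y ≤ δ + ε := fun y => by
    linarith [dist_triangle (φ (z (c y))) (w (c y)) y, hz (c y), hcδ _ _ (hcw y)]
  have hψ : Measurable fun y => z (c y) := (measurable_of_countable z).comp hc
  have hZD : ∀ x x' : Z, dist x x' ≤ D + ε := fun x x' => by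
    linarith [hε.dist_le x x', hD (φ x) (φ x')]
  -- `T` must spread mass to control entropy. `Ψ` serves only for competitors in the variance, where
  -- entropy plays no role, so it can send each cell to one point.
  refine ⟨fun μ => ⟨(μ : Measure Y).bind (cellKernel hc m (c ∘ φ) z), inferInstance⟩,
    fun ν => ν.map hψ.aemeasurable, fun μ ν => ?_, fun μ hμ => ⟨?_, fun ν => ?_⟩⟩
  · refine wassersteinSq_comp_map_le (cellKernel hc m (c ∘ φ) z) hψ (fun y y' => ?_) rfl rfl
    have hae : ∀ᵐ x ∂cellKernel hc m (c ∘ φ) z y, dist (φ x) y ≤ δ + ε := by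
      refine ae_cellKernel hb y (fun x hx => ?_) (hzy y)
        (measurableSet_le (hφ.dist measurable_const) measurable_const)
      linarith [hcδ (φ x) y hx]
    filter_upwards [hae] with x hx
    refine edist_sq_le_add (by positivity) ((hD y y').trans (by linarith)) ?_
    linarith [hε.dist_le x (z (c y')), hzy y', dist_triangle4_right (φ x) (φ (z (c y'))) y y']
  · exact relEntropy_bind_cellKernel hb (μ : Measure Y) hμ rfl
  -- The way back conditions `μ` itself on each cell, which recovers `μ` exactly from `T μ`.
  · refine wassersteinSq_comp_map_le (cellKernel hb (μ : Measure Y) c w) hφ (fun x x' => ?_)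
      (bind_cellKernel_bind_cellKernel hb (μ : Measure Y) hμ w).symm rfl
    have hae : ∀ᵐ y ∂cellKernel hb (μ : Measure Y) c w x, dist y (φ x) ≤ δ := by
      refine ae_cellKernel hc x (fun y hy => hcδ _ _ hy) (hcδ _ _ (hcw (φ x)))
        (measurableSet_le (measurable_id.dist measurable_const) measurable_const)
    filter_upwards [hae] with y hy
    refine edist_sq_le_add (by positivity) (hZD x x') ?_
    linarith [hε.dist_map_le x x', dist_triangle y (φ x) (φ x')]

/-- Along a measured Gromov--Hausdorff convergent sequence, finitely many measures of finite entropy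
can be transferred with arbitrarily small error. -/
theorem eventually_exists_transfer {X : ℕ → Type*} [∀ i, MetricSpace (X i)]
    [∀ i, CompactSpace (X i)] [∀ i, MeasurableSpace (X i)] [∀ i, BorelSpace (X i)]
    {m : ∀ i, Measure (X i)} [∀ i, IsFiniteMeasure (m i)]
    {Y : Type*} [MetricSpace Y] [CompactSpace Y] [MeasurableSpace Y] [BorelSpace Y] [Nonempty Y]
    {mY : Measure Y} [IsFiniteMeasure mY] (hmY : mY ≠ 0) {ε : ℕ → ℝ} {φ : ∀ i, X i → Y}
    (hε : Tendsto ε atTop (𝓝 0)) (hφ : ∀ i, IsApproximation (ε i) (φ i))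
    (hφm : ∀ i, Measurable (φ i))
    (hconv : ∀ g : Y →ᵇ ℝ,
      Tendsto (fun i => ∫ y, g y ∂((m i).map (φ i))) atTop (𝓝 (∫ y, g y ∂mY)))
    (s : Finset (ProbabilityMeasure Y)) {e : ProbabilityMeasure Y → ℝ}
    (he : ∀ μ ∈ s, relEntropy mY μ = e μ) {η : ℝ} (hη : 0 < η) :
    ∀ᶠ i in atTop, ∃ T Ψ : ProbabilityMeasure Y → ProbabilityMeasure (X i),
      (∀ μ ν, wassersteinSq (T μ) (Ψ ν) ≤ wassersteinSq μ ν + ENNReal.ofReal η) ∧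
      ∀ μ ∈ s, (∃ e' : ℝ, relEntropy (m i) (T μ) = e' ∧ e' ≤ e μ + η) ∧
        ∀ ν : ProbabilityMeasure (X i), wassersteinSq μ (ν.map (hφm i).aemeasurable) ≤
          wassersteinSq (T μ) ν + ENNReal.ofReal η := by
  classical
  obtain ⟨D, hD⟩ := Metric.isBounded_iff.1 (isCompact_univ (X := Y)).isBounded
  replace hD : ∀ y y' : Y, dist y y' ≤ D := fun y y' => hD (Set.mem_univ y) (Set.mem_univ y')
  have hD0 : 0 ≤ D := dist_nonneg.trans (hD (Classical.arbitrary Y) (Classical.arbitrary Y))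
  -- For $\varepsilon_i<\tau\le1$ the transfer error is at most
  -- $2(D+1)5\tau+(5\tau)^2\le\tau(10D+35)$.
  set τ : ℝ := min 1 (η / (10 * D + 35)) with hτ
  have hτ0 : 0 < τ := lt_min one_pos (by positivity)
  have hτη : τ * (10 * D + 35) ≤ η := by
    rw [← le_div_iff₀ (by positivity)]; exact min_le_right _ _
  obtain ⟨t, c, hc, hcf, hcτ⟩ := exists_measurable_finite_partition mY hτ0
  have hcell : ∀ j, Tendsto (fun i => (m i).real (c ∘ φ i ⁻¹' {j})) atTop
      (𝓝 (mY.real (c ⁻¹' {j}))) := fun j => by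
    have h := tendsto_measureReal_of_null_frontier hmY hconv (hcf j)
    simp only [map_measureReal_apply (hφm _) (hc (measurableSet_singleton j))] at h
    exact h
  have hnull : ∀ μ ∈ s, ∀ j, mY.real (c ⁻¹' {j}) = 0 → (μ : Measure Y) (c ⁻¹' {j}) = 0 := by
    intro μ hμ j hj
    have := he μ hμ
    unfold relEntropy at this
    split_ifs at this with h
    · rw [measureReal_eq_zero_iff] at hj
      exact h.1 hj
    · exact absurd this (by simp)
  -- There are finitely many cells, so eventually `m i` charges all those charged by `mY`, hence all
  -- those charged by some `μ ∈ s`.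
  have hpos : ∀ᶠ i in atTop, ∀ j, mY.real (c ⁻¹' {j}) ≠ 0 →
      (m i).real (c ∘ φ i ⁻¹' {j}) ≠ 0 := by
    refine eventually_all.2 fun j => ?_
    by_cases hj : mY.real (c ⁻¹' {j}) = 0
    · exact Eventually.of_forall fun i h => absurd hj h
    · exact ((hcell j).eventually_ne hj).mono fun i h _ => h
  have hent : ∀ᶠ i in atTop, ∀ μ ∈ s,
      cellEntropy (fun j => (μ : Measure Y).real (c ⁻¹' {j}))
        (fun j => (m i).real (c ∘ φ i ⁻¹' {j})) ≤ e μ + η := by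
    refine (Filter.eventually_all_finset s).2 fun μ hμ => ?_
    have h1 := tendsto_cellEntropy hcell (p := fun j => (μ : Measure Y).real (c ⁻¹' {j}))
      fun j hj => (measureReal_eq_zero_iff).2 (hnull μ hμ j hj)
    exact (h1.eventually_lt_const ((cellEntropy_le (he μ hμ) hc).trans_lt
      (lt_add_of_pos_right _ hη))).mono fun i hi => hi.le
  filter_upwards [hpos, hent, hε.eventually_lt_const hτ0] with i hi1 hi2 hi3
  have hε0 := (hφ i).nonneg
  obtain ⟨T, Ψ, h1, h2⟩ := (hφ i).exists_transfer (hφm i) hτ0.le hD hc hcτ (m i)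
  have hC : ENNReal.ofReal (2 * (D + ε i) * (2 * τ + 3 * ε i) + (2 * τ + 3 * ε i) ^ 2) ≤
      ENNReal.ofReal η := by
    refine ENNReal.ofReal_le_ofReal ?_
    have hτ1 : τ ≤ 1 := min_le_left _ _
    have h3 : 2 * τ + 3 * ε i ≤ 5 * τ := by linarith
    calc 2 * (D + ε i) * (2 * τ + 3 * ε i) + (2 * τ + 3 * ε i) ^ 2
        ≤ 2 * (D + 1) * (5 * τ) + (5 * τ) ^ 2 := by gcongr; linarith
      _ ≤ τ * (10 * D + 35) := by nlinarith
      _ ≤ η := hτη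
  refine ⟨T, Ψ, fun μ ν => (h1 μ ν).trans (by gcongr), fun μ hμ => ?_⟩
  obtain ⟨h3, h4⟩ := h2 μ fun j hj => hnull μ hμ j (by
    by_contra h
    exact hi1 j h ((measureReal_eq_zero_iff).2 hj))
  exact ⟨⟨_, h3, hi2 μ hμ⟩, fun ν => (h4 ν).trans (by gcongr)⟩

/-! ### Barycenters, and passage of entropy bounds to the limit. -/

theorem IsWassersteinBarycenter.wassersteinVar_eq {X : Type*} [MetricSpace X]
    [MeasurableSpace X] {Ω : Measure (ProbabilityMeasure X)} {ν : ProbabilityMeasure X} (h : IsWassersteinBarycenter Ω ν) :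
    wassersteinVar Ω = meanWassersteinSq Ω ν :=
  le_antisymm (iInf_le _ ν) (le_iInf h)

section Barycenter

variable {X : Type*} [MetricSpace X] [CompactSpace X] [MeasurableSpace X] [BorelSpace X]

theorem meanWassersteinSq_sum_smul_dirac {ι : Type*} (s : Finset ι) (w : ι → ℝ≥0∞)
    (x : ι → ProbabilityMeasure X) (ν : ProbabilityMeasure X) :
    meanWassersteinSq (∑ k ∈ s, w k • Measure.dirac (x k)) ν =
      ∑ k ∈ s, w k * wassersteinSq (x k) ν :=
  lintegral_sum_smul_dirac s w x _

theorem lowerSemicontinuous_meanWassersteinSq {ι : Type*} (s : Finset ι) {w : ι → ℝ≥0∞}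
    (hw : ∀ k ∈ s, w k ≠ ∞) (x : ι → ProbabilityMeasure X) :
    LowerSemicontinuous
      (meanWassersteinSq (∑ k ∈ s, w k • Measure.dirac (x k))) := by
  have : meanWassersteinSq (∑ k ∈ s, w k • Measure.dirac (x k)) =
      fun ν => ∑ k ∈ s, w k * wassersteinSq (x k) ν :=
    funext (meanWassersteinSq_sum_smul_dirac s w x)
  rw [this]
  refine lowerSemicontinuous_sum fun k hk => ?_
  exact (ENNReal.continuous_const_mul (hw k hk)).comp_lowerSemicontinuous
    (lowerSemicontinuous_wassersteinSq_right (x k)) fun a b hab =>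
      mul_le_mul_right hab _

theorem exists_isWassersteinBarycenter [Nonempty (ProbabilityMeasure X)] {ι : Type*} (s : Finset ι)
    {w : ι → ℝ≥0∞} (hw : ∀ k ∈ s, w k ≠ ∞) (x : ι → ProbabilityMeasure X) :
    ∃ ν, IsWassersteinBarycenter (∑ k ∈ s, w k • Measure.dirac (x k)) ν := by
  obtain ⟨ν, -, hν⟩ := ((lowerSemicontinuous_meanWassersteinSq s hw x).lowerSemicontinuousOn
    Set.univ).exists_isMinOn Set.univ_nonempty isCompact_univ
  exact ⟨ν, fun ν' => hν (Set.mem_univ ν')⟩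

end Barycenter

theorem sum_mul_le_sum_mul_add {ι : Type*} {s : Finset ι} {w : ι → ℝ≥0∞}
    (hw : ∑ k ∈ s, w k = 1) {f g : ι → ℝ≥0∞} {c : ℝ≥0∞} (h : ∀ k ∈ s, f k ≤ g k + c) :
    ∑ k ∈ s, w k * f k ≤ ∑ k ∈ s, w k * g k + c := by
  calc ∑ k ∈ s, w k * f k ≤ ∑ k ∈ s, w k * (g k + c) :=
        Finset.sum_le_sum fun k hk => by gcongr; exact h k hk
    _ = ∑ k ∈ s, w k * g k + c := by
        simp_rw [mul_add]
        rw [Finset.sum_add_distrib, ← Finset.sum_mul, hw, one_mul]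

/-- Lower semicontinuity of the entropy along measured Gromov--Hausdorff convergence. -/
theorem relEntropy_le_of_tendsto {ι : Type*} {L : Filter ι} [L.NeBot] {Z : ι → Type*}
    [∀ i, MeasurableSpace (Z i)] {m : ∀ i, Measure (Z i)} [∀ i, IsFiniteMeasure (m i)]
    {Y : Type*} [MetricSpace Y] [MeasurableSpace Y] [BorelSpace Y] {mY : Measure Y}
    [IsFiniteMeasure mY] {φ : ∀ i, Z i → Y} (hφ : ∀ i, Measurable (φ i))
    (hm : ∀ g : Y →ᵇ ℝ, Tendsto (fun i => ∫ y, g y ∂((m i).map (φ i))) L (𝓝 (∫ y, g y ∂mY)))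
    {ν : ∀ i, ProbabilityMeasure (Z i)} {νY : ProbabilityMeasure Y}
    (hν : Tendsto (fun i => (ν i).map (hφ i).aemeasurable) L (𝓝 νY)) {r : ι → ℝ} {r₀ : ℝ}
    (hr : Tendsto r L (𝓝 r₀)) (h : ∀ i, relEntropy (m i) (ν i) ≤ r i) :
    relEntropy mY νY ≤ r₀ := by
  refine relEntropy_le_of_forall_continuous fun g => ?_
  set f : Y →ᵇ ℝ := BoundedContinuousFunction.ofNormedAddCommGroup
    (fun y => Real.exp (g y - 1)) (Real.continuous_exp.comp (g.continuous.sub continuous_const))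
    (Real.exp (‖g‖ - 1)) (fun y => by
      rw [Real.norm_eq_abs, Real.abs_exp, Real.exp_le_exp]
      linarith [(le_abs_self (g y)).trans (g.norm_coe_le_norm y)]) with hf
  -- Both Donsker--Varadhan terms are integrals of bounded continuous functions, so they converge
  -- for varying reference measures.
  have h1 := ((ProbabilityMeasure.tendsto_iff_forall_integral_tendsto.1 hν) g).sub (hm f)
  refine le_of_tendsto_of_tendsto' h1 hr fun i => ?_
  obtain ⟨e, he⟩ : ∃ e : ℝ, relEntropy (m i) (ν i) = e :=
    ⟨_, (EReal.coe_toReal (ne_top_of_le_ne_top (EReal.coe_ne_top _) (h i))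
      (relEntropy_ne_bot _ _)).symm⟩
  have h2 := integral_sub_integral_exp_le_of_relEntropy_eq he (g := g ∘ φ i)
    (g.continuous.measurable.comp (hφ i)) (fun x => g.norm_coe_le_norm (φ i x))
  have h3 := h i
  rw [he, EReal.coe_le_coe_iff] at h3
  refine le_trans (le_of_eq ?_) (h2.trans h3)
  rw [ProbabilityMeasure.toMeasure_map,
    integral_map (hφ i).aemeasurable g.continuous.measurable.aestronglyMeasurable,
    integral_map (hφ i).aemeasurable f.continuous.measurable.aestronglyMeasurable]
  rfl

/-- Barycenters of transferred measures are almost barycenters, and almost satisfy Jensen's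
inequality. -/
theorem eventually_exists_almost_barycenter {K : ℝ} {X : ℕ → Type*} [∀ i, MetricSpace (X i)]
    [∀ i, CompactSpace (X i)] [∀ i, MeasurableSpace (X i)] [∀ i, BorelSpace (X i)]
    {m : ∀ i, Measure (X i)} [∀ i, IsFiniteMeasure (m i)] (hBCD : ∀ i, IsBCD K (m i))
    {Y : Type*} [MetricSpace Y] [CompactSpace Y] [MeasurableSpace Y] [BorelSpace Y] [Nonempty Y]
    {mY : Measure Y} [IsFiniteMeasure mY] (hmY : mY ≠ 0) {ε : ℕ → ℝ} {φ : ∀ i, X i → Y}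
    (hε : Tendsto ε atTop (𝓝 0)) (hφ : ∀ i, IsApproximation (ε i) (φ i))
    (hφm : ∀ i, Measurable (φ i))
    (hconv : ∀ g : Y →ᵇ ℝ,
      Tendsto (fun i => ∫ y, g y ∂((m i).map (φ i))) atTop (𝓝 (∫ y, g y ∂mY)))
    {s : Finset (ProbabilityMeasure Y)} {w : ProbabilityMeasure Y → ℝ≥0∞}
    (hw : ∑ μ ∈ s, w μ = 1) {e : ProbabilityMeasure Y → ℝ}
    (he : ∀ μ ∈ s, relEntropy mY μ = e μ) {νY : ProbabilityMeasure Y}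
    (hνY : IsWassersteinBarycenter (∑ μ ∈ s, w μ • Measure.dirac μ) νY)
    (hfin : meanWassersteinSq (∑ μ ∈ s, w μ • Measure.dirac μ) νY < ∞) {η : ℝ} (hη : 0 < η) :
    ∀ᶠ i in atTop, ∃ ν : ProbabilityMeasure (X i),
      meanWassersteinSq (∑ μ ∈ s, w μ • Measure.dirac μ) (ν.map (hφm i).aemeasurable) ≤
        meanWassersteinSq (∑ μ ∈ s, w μ • Measure.dirac μ) νY +
          (ENNReal.ofReal η + ENNReal.ofReal η) ∧
      relEntropy (m i) ν ≤ ((∑ μ ∈ s, (w μ).toReal * e μ - K / 2 *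
        (meanWassersteinSq (∑ μ ∈ s, w μ • Measure.dirac μ) νY).toReal +
          (1 + |K| / 2) * η : ℝ) : EReal) := by
  have hwt : ∀ μ ∈ s, w μ ≠ ∞ := fun μ hμ =>
    ne_top_of_le_ne_top ENNReal.one_ne_top (hw ▸ Finset.single_le_sum (fun _ _ => zero_le) hμ)
  have hwr : ∑ μ ∈ s, (w μ).toReal = 1 := by
    rw [← ENNReal.toReal_sum hwt, hw, ENNReal.toReal_one]
  filter_upwards [eventually_exists_transfer hmY hε hφ hφm hconv s he hη] with i hi
  obtain ⟨T, Ψ, hTΨ, hT⟩ := hi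
  choose! e' he' hee' using fun μ hμ => (hT μ hμ).1
  set Ω := ∑ μ ∈ s, w μ • Measure.dirac μ with hΩ
  set Ω' : Measure (ProbabilityMeasure (X i)) := ∑ μ ∈ s, w μ • Measure.dirac (T μ) with hΩ'
  have hΩ'p : IsProbabilityMeasure Ω' := ⟨by
    rw [hΩ', Measure.coe_finsetSum, Finset.sum_apply]
    simpa using hw⟩
  have hΩ's : ∃ S : Set (ProbabilityMeasure (X i)), S.Finite ∧ ∀ᵐ μ ∂Ω', μ ∈ S := by
    classical
    refine ⟨(s.image T : Finset _), Finset.finite_toSet _, ?_⟩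
    rw [hΩ', ae_iff, Measure.coe_finsetSum, Finset.sum_apply]
    refine Finset.sum_eq_zero fun μ hμ => ?_
    have : T μ ∈ s.image T := Finset.mem_image_of_mem T hμ
    simp only [Measure.smul_apply, smul_eq_mul, Measure.dirac_apply, mul_eq_zero]
    right
    refine Set.indicator_of_notMem (fun h => ?_) _
    exact (show ¬ T μ ∈ (↑(s.image T) : Set _) from h) (Finset.mem_coe.2 this)
  -- The barycenter on `Y`, moved by `Ψ`, is a competitor on `X i`; conversely, in `hlow` the
  -- barycenter `ν` found on `X i` is mapped back to `Y`.
  have hup : meanWassersteinSq Ω' (Ψ νY) ≤ meanWassersteinSq Ω νY + ENNReal.ofReal η := by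
    rw [hΩ, hΩ', meanWassersteinSq_sum_smul_dirac s w T,
      meanWassersteinSq_sum_smul_dirac s w fun μ => μ]
    exact sum_mul_le_sum_mul_add hw fun μ _ => hTΨ μ νY
  have hfinη : meanWassersteinSq Ω νY + ENNReal.ofReal η < ∞ :=
    ENNReal.add_lt_top.2 ⟨hfin, ENNReal.ofReal_lt_top⟩
  have hvarfin : wassersteinVar Ω' < ∞ := (iInf_le _ (Ψ νY)).trans_lt (hup.trans_lt hfinη)
  obtain ⟨ν, hν, hνent⟩ := hBCD i Ω' hΩ'p hΩ's hvarfin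
  have hvar := hν.wassersteinVar_eq
  have hV' : meanWassersteinSq Ω' ν ≤ meanWassersteinSq Ω νY + ENNReal.ofReal η :=
    (hν _).trans hup
  have hlow : meanWassersteinSq Ω (ν.map (hφm i).aemeasurable) ≤
      meanWassersteinSq Ω' ν + ENNReal.ofReal η := by
    rw [hΩ, hΩ', meanWassersteinSq_sum_smul_dirac s w T,
      meanWassersteinSq_sum_smul_dirac s w fun μ => μ]
    exact sum_mul_le_sum_mul_add hw fun μ hμ => (hT μ hμ).2 ν
  refine ⟨ν, ?_, ?_⟩
  · rw [← add_assoc]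
    exact hlow.trans (by gcongr)
  · rw [hΩ', erealIntegral_sum_smul_dirac s w T hwt he', ← hΩ', hvar, ← EReal.coe_sub] at hνent
    refine hνent.trans (EReal.coe_le_coe_iff.2 ?_)
    have h1 : ∑ μ ∈ s, (w μ).toReal * e' μ ≤ ∑ μ ∈ s, (w μ).toReal * e μ + η := by
      calc ∑ μ ∈ s, (w μ).toReal * e' μ ≤ ∑ μ ∈ s, (w μ).toReal * (e μ + η) :=
            Finset.sum_le_sum fun μ hμ =>
              mul_le_mul_of_nonneg_left (hee' μ hμ) ENNReal.toReal_nonneg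
        _ = ∑ μ ∈ s, (w μ).toReal * e μ + η := by
            simp_rw [mul_add]
            rw [Finset.sum_add_distrib, ← Finset.sum_mul, hwr, one_mul]
    have h2 : (meanWassersteinSq Ω' ν).toReal ≤ (meanWassersteinSq Ω νY).toReal + η := by
      have := ENNReal.toReal_mono hfinη.ne hV'
      rwa [ENNReal.toReal_add hfin.ne ENNReal.ofReal_ne_top, ENNReal.toReal_ofReal hη.le] at this
    have h3 : (meanWassersteinSq Ω νY).toReal ≤ (meanWassersteinSq Ω' ν).toReal + η := by
      have hfin' : meanWassersteinSq Ω' ν ≠ ∞ := (hV'.trans_lt hfinη).ne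
      have := ENNReal.toReal_mono (ENNReal.add_ne_top.2 ⟨hfin', ENNReal.ofReal_ne_top⟩)
        ((hνY _).trans hlow)
      rwa [ENNReal.toReal_add hfin' ENNReal.ofReal_ne_top, ENNReal.toReal_ofReal hη.le] at this
    -- The sign of $K$ is arbitrary, so the variances must be compared in both directions.
    have h4 : |K / 2 * ((meanWassersteinSq Ω νY).toReal - (meanWassersteinSq Ω' ν).toReal)| ≤
        |K| / 2 * η := by
      rw [abs_mul, abs_div, abs_two]
      gcongr
      exact abs_le.2 ⟨by linarith, by linarith⟩
    have h5 := (abs_le.1 h4).2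
    linarith

end BCD

/-! ### Passage to the limit. -/

theorem mainTheorem9 (K : ℝ)
    {X : ℕ → Type*} [∀ i, MetricSpace (X i)] [∀ i, CompactSpace (X i)]
    [∀ i, MeasurableSpace (X i)] [∀ i, BorelSpace (X i)]
    (m : ∀ i, Measure (X i)) [∀ i, IsFiniteMeasure (m i)] [∀ i, (m i).IsOpenPosMeasure]
    {Y : Type*} [MetricSpace Y] [CompleteSpace Y] [MeasurableSpace Y] [BorelSpace Y]
    (mY : Measure Y) [IsFiniteMeasure mY] [mY.IsOpenPosMeasure]
    (hBCD : ∀ i, BCD.IsBCD K (m i))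
    (hconv : BCD.MeasuredGHConverges m mY) :
    BCD.IsBCD K mY := by
  obtain ⟨ε, φ, hε, hφ, hφm, hconv⟩ := hconv
  have : CompactSpace Y := BCD.compactSpace_of_isApproximation hε hφ
  intro Ω hΩp hΩs hvar
  obtain ⟨s, w, hw0, rfl⟩ : ∃ (s : Finset (ProbabilityMeasure Y)) (w : ProbabilityMeasure Y → ℝ≥0∞),
      (∀ μ ∈ s, w μ ≠ 0) ∧ Ω = ∑ μ ∈ s, w μ • Measure.dirac μ := by
    obtain ⟨s, hs0, hΩ⟩ := BCD.exists_finset_eq_sum_smul_dirac hΩs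
    exact ⟨s, fun μ => Ω {μ}, hs0, hΩ⟩
  have hw1 : ∑ μ ∈ s, w μ = 1 := by
    have h := hΩp.measure_univ
    rw [Measure.coe_finsetSum, Finset.sum_apply] at h
    simpa using h
  have hwt : ∀ μ ∈ s, w μ ≠ ∞ := fun μ hμ =>
    ne_top_of_le_ne_top ENNReal.one_ne_top
      (hw1 ▸ Finset.single_le_sum (fun _ _ => zero_le) hμ)
  obtain ⟨μ₀, -⟩ : s.Nonempty := by
    rw [Finset.nonempty_iff_ne_empty]
    rintro rfl
    simp at hw1
  have : Nonempty (ProbabilityMeasure Y) := ⟨μ₀⟩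
  have : Nonempty Y := μ₀.nonempty
  have hmY : mY ≠ 0 := NeZero.ne mY
  obtain ⟨ν₀, hν₀⟩ := BCD.exists_isWassersteinBarycenter s hwt fun μ => μ
  by_cases htop : ∃ μ ∈ s, BCD.relEntropy mY μ = ⊤
  · obtain ⟨μ, hμ, hμt⟩ := htop
    refine ⟨ν₀, hν₀, ?_⟩
    rw [BCD.erealIntegral_sum_smul_dirac_eq_top s w (fun μ => μ) hwt (BCD.relEntropy_ne_bot mY) hμ
      (hw0 μ hμ) hμt, EReal.top_sub_coe]
    exact le_top
  push Not at htop
  set e : ProbabilityMeasure Y → ℝ := fun μ => (BCD.relEntropy mY μ).toReal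
  have he : ∀ μ ∈ s, BCD.relEntropy mY μ = e μ := fun μ hμ =>
    (EReal.coe_toReal (htop μ hμ) (BCD.relEntropy_ne_bot mY μ)).symm
  have hfin := hvar
  rw [hν₀.wassersteinVar_eq] at hfin
  -- Diagonal choice: an index `i n ≥ n` at which the error is $1/(n+1)$.
  choose i hi ν hν1 hν2 using fun n : ℕ => ((eventually_ge_atTop n).and
    (BCD.eventually_exists_almost_barycenter hBCD hmY hε hφ hφm hconv hw1 he hν₀ hfin
      (η := 1 / (n + 1)) (by positivity))).exists
  -- Limits along an ultrafilter finer than `atTop` replace the extraction of a subsequence.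
  set U : Ultrafilter ℕ := Ultrafilter.of atTop
  have hU : (U : Filter ℕ) ≤ atTop := Ultrafilter.of_le atTop
  have hiU : Tendsto i U atTop := (tendsto_atTop_mono hi tendsto_id).mono_left hU
  have hη : Tendsto (fun n : ℕ => 1 / ((n : ℝ) + 1)) U (𝓝 0) :=
    tendsto_one_div_add_atTop_nhds_zero_nat.mono_left hU
  obtain ⟨νY, -, hνY⟩ := isCompact_univ.ultrafilter_le_nhds
    (U.map fun n => (ν n).map (hφm (i n)).aemeasurable) (by simp)
  have hνY' : Tendsto (fun n => (ν n).map (hφm (i n)).aemeasurable) U (𝓝 νY) := hνY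
  have hbar : BCD.IsWassersteinBarycenter (∑ μ ∈ s, w μ • Measure.dirac μ) νY := by
    refine fun ν' => le_trans ?_ (hν₀ ν')
    refine le_of_forall_lt_imp_le_of_dense fun a ha => ?_
    have hlim : Tendsto (fun n : ℕ =>
        BCD.meanWassersteinSq (∑ μ ∈ s, w μ • Measure.dirac μ) ν₀ +
          (ENNReal.ofReal (1 / ((n : ℝ) + 1)) + ENNReal.ofReal (1 / ((n : ℝ) + 1)))) U
        (𝓝 (BCD.meanWassersteinSq (∑ μ ∈ s, w μ • Measure.dirac μ) ν₀ +
          (ENNReal.ofReal 0 + ENNReal.ofReal 0))) :=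
      tendsto_const_nhds.add ((ENNReal.tendsto_ofReal hη).add (ENNReal.tendsto_ofReal hη))
    rw [ENNReal.ofReal_zero, add_zero, add_zero] at hlim
    refine ge_of_tendsto hlim ?_
    filter_upwards [hνY'.eventually
      (BCD.lowerSemicontinuous_meanWassersteinSq s hwt (fun μ => μ) νY a ha)] with n hn
    exact hn.le.trans (hν1 n)
  -- The limit `νY` may differ from `ν₀`, which only supplies the value of the variance.
  refine ⟨νY, hbar, ?_⟩
  rw [BCD.erealIntegral_sum_smul_dirac s w (fun μ => μ) hwt he, hν₀.wassersteinVar_eq,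
    ← EReal.coe_sub]
  refine BCD.relEntropy_le_of_tendsto (fun n => hφm (i n)) (fun g => (hconv g).comp hiU) hνY'
    (r := _) ?_ hν2
  have := (hη.const_mul (1 + |K| / 2)).const_add (∑ μ ∈ s, (w μ).toReal * e μ - K / 2 *
        (BCD.meanWassersteinSq (∑ μ ∈ s, w μ • Measure.dirac μ) ν₀).toReal)
  simpa using this
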